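/- Let $\mu>0$ and $T>0$. Two sensors A and B send status updates to a monitor. From time $0$ on, each sensor generates an update, transmits it, and generates its next update at the very moment the previous one is received. The service (transmission) times of A are i.i.d. exponential random variables with rate $\mu$, and every service time of B equals $T$ (the M-D system). The age of information (AoI) at time $t$ is $\Delta(t)=t-u(t)$, where $u(t)$ is the generation time of the freshest update received up to time $t$ (with an arbitrary initial age $\Delta(0)=\Delta_0\ge 0$). A received update is obsolete, and is discarded, if it does not reduce the AoI; the value of the AoI immediately before the reception of a non-obsolete update is a peak AoI (PAoI). Then the average PAoI of the M-D system equals $$\Delta^{\mathrm{peak}}_{\text{M-D}}=\frac{2+2\mu T+e^{\mu T}\bigl(-2+\mu T(2e^{\mu T}+\mu T)\bigr)}{\mu\bigl(1+e^{\mu T}(1+e^{\mu T})\mu T\bigr)},$$ in both of the following senses. (i) Almost surely, only finitely many peaks occur in each $(0,\tau]$, and the arithmetic mean of the PAoI values in $(0,\tau]$ converges to $\Delta^{\mathrm{peak}}_{\text{M-D}}$ as $\tau\to\infty$. (ii) For every service period $(jT,(j+1)T]$ of B with $j\ge 1$, the sum $A_j$ and the number $N_j$ of the PAoI values in that period are integrable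 and $\mathbb{E}[A_j]/\mathbb{E}[N_j]=\Delta^{\mathrm{peak}}_{\text{M-D}}$. -/

import Mathlib

open MeasureTheory ProbabilityTheory Filter Topology

noncomputable section

/-- The time at which a sensor with service times `s 0, s 1, …` generates its `n`-th update
(`n = 0, 1, …`). The first update is generated at time `0`, and every later one at the moment
at which its predecessor has been received (feedback is instantaneous). -/
def genTime (s : ℕ → ℝ) (n : ℕ) : ℝ := ∑ i ∈ Finset.range n, s i

/-- The time at which the monitor receives the `n`-th update of a sensor with service
times `s`. -/
def recvTime (s : ℕ → ℝ) (n : ℕ) : ℝ := genTime s n + s n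

/-- All updates of the dual-queue system in which the two sensors have service times `sA` and
`sB`, each recorded as the pair (generation time, reception time). -/
def updates (sA sB : ℕ → ℝ) : Set (ℝ × ℝ) :=
  Set.range (fun n => (genTime sA n, recvTime sA n)) ∪
    Set.range (fun n => (genTime sB n, recvTime sB n))

/-- The age of information at the monitor immediately before time `t`: the time elapsed since
the generation of the freshest update received strictly before `t`. The age at time `0` is
`Δ₀`, i.e. the monitor initially holds information generated at time `-Δ₀`. -/
def ageBefore (Δ₀ : ℝ) (U : Set (ℝ × ℝ)) (t : ℝ) : ℝ :=
  t - sSup (insert (-Δ₀) {g | ∃ r, (g, r) ∈ U ∧ r < t})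

/-- The times at which the monitor receives a non-obsolete update, i.e. one whose age is smaller
than the age currently observed at the monitor. These are the times of the peaks of the age. -/
def peakTimes (Δ₀ : ℝ) (U : Set (ℝ × ℝ)) : Set ℝ :=
  {t | ∃ g, (g, t) ∈ U ∧ t - g < ageBefore Δ₀ U t}

/-- The number of age peaks in the time window `I`. -/
def peakCount (Δ₀ : ℝ) (U : Set (ℝ × ℝ)) (I : Set ℝ) : ℝ :=
  ((peakTimes Δ₀ U ∩ I).ncard : ℝ)

/-- The sum of the values of the age peaks in the time window `I`. A peak value is the
age immediately before the reception of a non-obsolete update. -/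
def peakSum (Δ₀ : ℝ) (U : Set (ℝ × ℝ)) (I : Set ℝ) : ℝ :=
  ∑ᶠ t ∈ peakTimes Δ₀ U ∩ I, ageBefore Δ₀ U t

/-- The updates of the M-D system: service times `sA` at the first sensor and the constant
service time `T` at the second one. -/
def updatesMD (sA : ℕ → ℝ) (T : ℝ) : Set (ℝ × ℝ) := updates sA (fun _ => T)

end

/-! Cut time at the multiples of `T`. Since the exponential law is memoryless, the service times of
A seen from `T` on (`cutSeq`) again have the law `serviceLaw μ`, and they are independent of what
happened in `(0, T)`. The successive observations `window` are therefore i.i.d. This is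
`lintegral_slot_residualSeq`, turned into `measure_window_inter_cutSeq`.

In a period `((i+1)T, (i+2)T]` the freshest update received earlier from B was generated at `iT`.
Hence an A-update is a peak exactly when it was generated after `iT`; this excludes at most the
first reception of the period, and does so exactly when the preceding period has no A-reception. The
update of B received at `(i+2)T` is a peak exactly when the period contains at most one A-reception.
Both the number and the sum of the peaks are thus functions of two consecutive windows,
`periodCount` and `periodSum` (`peakCount_eq`, `peakSum_eq`); the sum collapses by telescoping to
the first, last and last but one reception times.

With `q = exp (-μT)`, Poisson and exponential moments give mean count `μT + μT q + q²` and the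
corresponding mean sum (`hasMean_periodCount`, `hasMean_periodSum`). Their ratio is the asserted
value, which is (ii). For (i), the strong law for functions of consecutive pairs
(`ae_tendsto_average_pair`) gives the averages per period, and monotonicity in `τ` carries them over
to continuous time. -/

noncomputable section

/-! ### Independence of the successive observations of a regenerative map -/

section Iterates

variable {E 𝒳 : Type*} [MeasurableSpace E] [MeasurableSpace 𝒳] {ρ : Measure E}
  [IsProbabilityMeasure ρ] {θ : E → E} {X : E → 𝒳}

/-- If `θ` regenerates the law `ρ` independently of the observation `X`, then the successive
observations `X ∘ θ^[j]` are independent. -/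
theorem measure_iterate_inter (hθ : Measurable θ) (hX : Measurable X)
    (h : ∀ A B, MeasurableSet A → MeasurableSet B →
      ρ (X ⁻¹' A ∩ θ ⁻¹' B) = ρ (X ⁻¹' A) * ρ B) (n : ℕ) :
    ∀ A : ℕ → Set 𝒳, (∀ i, MeasurableSet (A i)) →
      ρ (⋂ i ∈ Finset.range n, (fun s => X (θ^[i] s)) ⁻¹' A i)
        = ∏ i ∈ Finset.range n, ρ (X ⁻¹' A i) := by
  induction n with
  | zero => intro A _; simp
  | succ n ih =>
    intro A hA
    have hset : (⋂ i ∈ Finset.range (n + 1), (fun s => X (θ^[i] s)) ⁻¹' A i)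
        = X ⁻¹' A 0 ∩ θ ⁻¹' (⋂ i ∈ Finset.range n, (fun s => X (θ^[i] s)) ⁻¹' A (i + 1)) := by
      ext s
      simp only [Set.mem_iInter, Finset.mem_range, Set.mem_preimage, Set.mem_inter_iff]
      constructor
      · intro hs
        exact ⟨hs 0 (by omega), fun i hi => hs (i + 1) (by omega)⟩
      · rintro ⟨h0, h1⟩ i hi
        cases i with
        | zero => exact h0
        | succ i => exact h1 i (by omega)
    rw [hset, h _ _ (hA 0), ih (fun i => A (i + 1)) (fun i => hA _), Finset.prod_range_succ', mul_comm]
    exact MeasurableSet.biInter (Finset.countable_toSet _)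
      fun i _ => (hX.comp (hθ.iterate i)) (hA _)

theorem measurePreserving_of_regenerative (hθ : Measurable θ)
    (h : ∀ A B, MeasurableSet A → MeasurableSet B →
      ρ (X ⁻¹' A ∩ θ ⁻¹' B) = ρ (X ⁻¹' A) * ρ B) : MeasurePreserving θ ρ ρ := by
  refine ⟨hθ, ?_⟩
  ext B hB
  rw [Measure.map_apply hθ hB]
  simpa using h Set.univ B MeasurableSet.univ hB

theorem iIndepFun_iterate (hθ : Measurable θ) (hX : Measurable X)
    (h : ∀ A B, MeasurableSet A → MeasurableSet B →
      ρ (X ⁻¹' A ∩ θ ⁻¹' B) = ρ (X ⁻¹' A) * ρ B) :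
    iIndepFun (fun j s => X (θ^[j] s)) ρ := by
  classical
  rw [iIndepFun_iff_measure_inter_preimage_eq_mul]
  intro S A hA
  have hmp := measurePreserving_of_regenerative hθ h
  -- Padding with `univ` outside `S` reduces an arbitrary finite index set to an initial segment.
  let A' : ℕ → Set 𝒳 := fun i => if i ∈ S then A i else Set.univ
  have hA' : ∀ i, MeasurableSet (A' i) := by
    intro i
    by_cases hi : i ∈ S
    · simpa [A', hi] using hA i hi
    · simp [A', hi]
  obtain ⟨n, hn⟩ := S.exists_nat_subset_range
  have key := measure_iterate_inter hθ hX h n A' hA'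
  have e1 : (⋂ i ∈ Finset.range n, (fun s => X (θ^[i] s)) ⁻¹' A' i)
      = ⋂ i ∈ S, (fun s => X (θ^[i] s)) ⁻¹' A i := by
    ext s
    simp only [Set.mem_iInter, Set.mem_preimage]
    constructor
    · intro hs i hi
      simpa [A', hi] using hs i (hn hi)
    · intro hs i _
      by_cases hi : i ∈ S
      · simpa [A', hi] using hs i hi
      · simp [A', hi]
  rw [e1] at key
  rw [key, ← Finset.prod_subset hn]
  · refine Finset.prod_congr rfl fun i hi => ?_
    have : (fun s => X (θ^[i] s)) ⁻¹' A i = θ^[i] ⁻¹' (X ⁻¹' A i) := rfl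
    rw [this, (hmp.iterate i).measure_preimage (hX (hA i hi)).nullMeasurableSet]
    simp [A', hi]
  · intro i _ hi
    simp [A', hi]

theorem identDistrib_iterate_pair (hθ : Measurable θ) (hX : Measurable X)
    (h : ∀ A B, MeasurableSet A → MeasurableSet B →
      ρ (X ⁻¹' A ∩ θ ⁻¹' B) = ρ (X ⁻¹' A) * ρ B) (j : ℕ) :
    IdentDistrib (fun s => (X (θ^[j] s), X (θ^[j + 1] s))) (fun s => (X s, X (θ s))) ρ ρ := by
  have hmp := (measurePreserving_of_regenerative hθ h).iterate j
  have hm : Measurable (fun s => (X s, X (θ s))) := by fun_prop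
  have e : (fun s => (X (θ^[j] s), X (θ^[j + 1] s))) = (fun s => (X s, X (θ s))) ∘ θ^[j] := by
    funext s
    simp [Function.iterate_succ_apply']
  rw [e]
  refine ⟨(hm.comp hmp.measurable).aemeasurable, hm.aemeasurable, ?_⟩
  rw [← Measure.map_map hm hmp.measurable, hmp.map_eq]

end Iterates

/-! ### Strong law for functions of two consecutive observations -/

/-- Averages along the even and odd indices determine the average along all indices. -/
theorem tendsto_average_of_even_odd (y : ℕ → ℝ) (m : ℝ)
    (h0 : Tendsto (fun n : ℕ => (∑ i ∈ Finset.range n, y (2 * i)) / n) atTop (𝓝 m))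
    (h1 : Tendsto (fun n : ℕ => (∑ i ∈ Finset.range n, y (2 * i + 1)) / n) atTop (𝓝 m)) :
    Tendsto (fun n : ℕ => (∑ i ∈ Finset.range n, y i) / n) atTop (𝓝 m) := by
  have hsplit : ∀ n, ∑ i ∈ Finset.range n, y i
      = ∑ i ∈ Finset.range ((n + 1) / 2), y (2 * i) + ∑ i ∈ Finset.range (n / 2), y (2 * i + 1) := by
    intro n
    induction n with
    | zero => simp
    | succ n ih =>
      rw [Finset.sum_range_succ, ih]
      rcases Nat.even_or_odd' n with ⟨k, rfl | rfl⟩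
      · have e1 : (2 * k + 1) / 2 = k := by omega
        have e2 : (2 * k + 1 + 1) / 2 = k + 1 := by omega
        have e3 : 2 * k / 2 = k := by omega
        rw [e1, e2, e3, Finset.sum_range_succ]; ring
      · have e1 : (2 * k + 1 + 1) / 2 = k + 1 := by omega
        have e2 : (2 * k + 1 + 1 + 1) / 2 = k + 1 := by omega
        have e3 : (2 * k + 1) / 2 = k := by omega
        rw [e1, e2, e3, Finset.sum_range_succ _ k, Finset.sum_range_succ _ k]; ring
  have hfloor : ∀ c : ℕ, Tendsto (fun n : ℕ => (((n + c) / 2 : ℕ) : ℝ) / n) atTop (𝓝 (1 / 2)) := by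
    intro c
    have hc : Tendsto (fun n : ℕ => (((c + 1 : ℕ) : ℝ)) / n) atTop (𝓝 0) :=
      tendsto_const_div_atTop_nhds_zero_nat _
    have lo : Tendsto (fun n : ℕ => (1 / 2 : ℝ) - ((c + 1 : ℕ) : ℝ) / n) atTop (𝓝 (1 / 2)) := by
      simpa using tendsto_const_nhds.sub hc
    have hi : Tendsto (fun n : ℕ => (1 / 2 : ℝ) + ((c + 1 : ℕ) : ℝ) / n) atTop (𝓝 (1 / 2)) := by
      simpa using tendsto_const_nhds.add hc
    refine tendsto_of_tendsto_of_tendsto_of_le_of_le' lo hi ?_ ?_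
    · filter_upwards [eventually_gt_atTop 0] with n hn
      have hn' : (0 : ℝ) < n := by exact_mod_cast hn
      rw [le_div_iff₀ hn', sub_mul, div_mul_cancel₀ _ hn'.ne']
      have h2 : n ≤ 2 * ((n + c) / 2) + (c + 1) := by omega
      have h2' : (n : ℝ) ≤ 2 * (((n + c) / 2 : ℕ) : ℝ) + ((c + 1 : ℕ) : ℝ) := by exact_mod_cast h2
      have : (0 : ℝ) ≤ ((c + 1 : ℕ) : ℝ) := by positivity
      linarith
    · filter_upwards [eventually_gt_atTop 0] with n hn
      have hn' : (0 : ℝ) < n := by exact_mod_cast hn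
      rw [div_le_iff₀ hn', add_mul, div_mul_cancel₀ _ hn'.ne']
      have h2 : 2 * ((n + c) / 2) ≤ n + (c + 1) := by omega
      have h2' : 2 * (((n + c) / 2 : ℕ) : ℝ) ≤ n + ((c + 1 : ℕ) : ℝ) := by exact_mod_cast h2
      have : (0 : ℝ) ≤ ((c + 1 : ℕ) : ℝ) := by positivity
      linarith
  have hdiv : ∀ c : ℕ, Tendsto (fun n : ℕ => (n + c) / 2) atTop atTop := by
    intro c
    refine tendsto_atTop.2 fun b => ?_
    filter_upwards [eventually_ge_atTop (2 * b)] with n hn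
    omega
  have l0 := (h0.comp (hdiv 1)).mul (hfloor 1)
  have l1 := (h1.comp (hdiv 0)).mul (hfloor 0)
  have l := l0.add l1
  have em : m * (1 / 2) + m * (1 / 2) = m := by ring
  rw [em] at l
  refine l.congr' ?_
  filter_upwards [eventually_ge_atTop 2] with n hn
  have p0 : (((n + 1) / 2 : ℕ) : ℝ) ≠ 0 := by
    have : (n + 1) / 2 ≠ 0 := by omega
    exact_mod_cast this
  have p1 : ((n / 2 : ℕ) : ℝ) ≠ 0 := by
    have : n / 2 ≠ 0 := by omega
    exact_mod_cast this
  simp only [Function.comp, add_zero]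
  rw [hsplit n, add_div]
  congr 1
  · field_simp
  · field_simp

section StrongLaw

variable {E 𝒳 : Type*} [MeasurableSpace E] [MeasurableSpace 𝒳] {ρ : Measure E}
  [IsProbabilityMeasure ρ] {θ : E → E} {X : E → 𝒳}

/-- The strong law of large numbers for a function of two consecutive observations. -/
theorem ae_tendsto_average_pair (hθ : Measurable θ) (hX : Measurable X)
    (h : ∀ A B, MeasurableSet A → MeasurableSet B →
      ρ (X ⁻¹' A ∩ θ ⁻¹' B) = ρ (X ⁻¹' A) * ρ B)
    {g : 𝒳 × 𝒳 → ℝ} (hg : Measurable g) (hint : Integrable (fun s => g (X s, X (θ s))) ρ) :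
    ∀ᵐ s ∂ρ, Tendsto (fun n : ℕ =>
      (∑ i ∈ Finset.range n, g (X (θ^[i] s), X (θ^[i + 1] s))) / n) atTop
      (𝓝 (∫ s, g (X s, X (θ s)) ∂ρ)) := by
  have hid : ∀ j, IdentDistrib (fun s => g (X (θ^[j] s), X (θ^[j + 1] s)))
      (fun s => g (X s, X (θ s))) ρ ρ := fun j =>
    (identDistrib_iterate_pair hθ hX h j).comp hg
  have hind := iIndepFun_iterate hθ hX h
  have hmeas : ∀ j, Measurable (fun s => X (θ^[j] s)) := fun j => hX.comp (hθ.iterate j)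
  -- Neighbouring pairs share an observation. Pairs whose indices have the same parity do not, so
  -- they are pairwise independent, which is all the strong law needs.
  have aux : ∀ c : ℕ, ∀ᵐ s ∂ρ, Tendsto (fun n : ℕ =>
      (∑ i ∈ Finset.range n, g (X (θ^[2 * i + c] s), X (θ^[2 * i + c + 1] s))) / n) atTop
      (𝓝 (∫ s, g (X s, X (θ s)) ∂ρ)) := by
    intro c
    have := strong_law_ae_real
      (fun i s => g (X (θ^[2 * i + c] s), X (θ^[2 * i + c + 1] s)))
      ((hid _).integrable_iff.2 hint) ?_ ?_
    · rw [(hid _).integral_eq] at this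
      exact this
    · intro i k hik
      exact (hind.indepFun_prodMk_prodMk hmeas (2 * i + c) (2 * i + c + 1) (2 * k + c)
        (2 * k + c + 1) (by omega) (by omega) (by omega) (by omega)).comp hg hg
    · intro i
      exact (hid _).trans (hid _).symm
  filter_upwards [aux 0, aux 1] with s s0 s1
  exact tendsto_average_of_even_odd _ _ s0 s1

end StrongLaw

/-! ### The law of the service times and memorylessness -/

/-- The sequence with first entry `x` followed by the sequence `s`. -/
def consSeq (x : ℝ) (s : ℕ → ℝ) : ℕ → ℝ
  | 0 => x
  | i + 1 => s i

@[simp] theorem consSeq_zero (x : ℝ) (s : ℕ → ℝ) : consSeq x s 0 = x := rfl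

@[simp] theorem consSeq_succ (x : ℝ) (s : ℕ → ℝ) (i : ℕ) : consSeq x s (i + 1) = s i := rfl

@[fun_prop]
theorem measurable_consSeq : Measurable (fun p : ℝ × (ℕ → ℝ) => consSeq p.1 p.2) := by
  refine measurable_pi_iff.2 fun i => ?_
  cases i with
  | zero => exact measurable_fst
  | succ i => exact (measurable_pi_apply i).comp measurable_snd

@[fun_prop]
theorem measurable_consSeq_right (x : ℝ) : Measurable (consSeq x) :=
  measurable_consSeq.comp measurable_prodMk_left

@[fun_prop]
theorem measurable_genTime (n : ℕ) : Measurable (fun s : ℕ → ℝ => genTime s n) := by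
  unfold genTime
  fun_prop

@[simp] theorem genTime_zero (s : ℕ → ℝ) : genTime s 0 = 0 := by simp [genTime]

theorem genTime_succ (s : ℕ → ℝ) (n : ℕ) : genTime s (n + 1) = genTime s n + s n :=
  Finset.sum_range_succ _ _

theorem genTime_consSeq (x : ℝ) (s : ℕ → ℝ) (n : ℕ) :
    genTime (consSeq x s) (n + 1) = x + genTime s n := by
  simp [genTime, Finset.sum_range_succ', add_comm]

theorem genTime_congr {s s' : ℕ → ℝ} {n : ℕ} (h : ∀ i < n, s i = s' i) {k : ℕ} (hk : k ≤ n) :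
    genTime s k = genTime s' k :=
  Finset.sum_congr rfl fun i hi => h i (by have := Finset.mem_range.1 hi; omega)

/-- The law of a sequence of independent exponential service times of rate `μ`. -/
def serviceLaw (μ : ℝ) : Measure (ℕ → ℝ) := Measure.infinitePi (fun _ => expMeasure μ)

theorem lintegral_expMeasure (μ : ℝ) {f : ℝ → ENNReal} (hf : Measurable f) :
    ∫⁻ x, f x ∂(expMeasure μ) = ∫⁻ x, exponentialPDF μ x * f x := by
  have : expMeasure μ = volume.withDensity (exponentialPDF μ) := rfl
  have hm : Measurable (exponentialPDF μ) := (measurable_exponentialPDFReal μ).ennreal_ofReal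
  rw [this, lintegral_withDensity_eq_lintegral_mul _ hm hf]
  rfl

theorem ae_pos_expMeasure (μ : ℝ) : ∀ᵐ x ∂(expMeasure μ), 0 < x := by
  have hm : Measurable (exponentialPDF μ) := (measurable_exponentialPDFReal μ).ennreal_ofReal
  have : expMeasure μ = volume.withDensity (exponentialPDF μ) := rfl
  rw [this, ae_withDensity_iff hm]
  have h0 : ∀ᵐ x : ℝ, x ≠ 0 := by simp [ae_iff]
  filter_upwards [h0] with x hx h
  by_contra hneg
  exact h (exponentialPDF_of_neg (lt_of_le_of_ne (not_lt.1 hneg) hx))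

/-- The exponential law is memoryless. -/
theorem lintegral_expMeasure_shift (μ : ℝ) {c : ℝ} (hc : 0 ≤ c) {f : ℝ → ENNReal}
    (hf : Measurable f) :
    ∫⁻ x, (if c ≤ x then f (x - c) else 0) ∂(expMeasure μ)
      = ENNReal.ofReal (Real.exp (-(μ * c))) * ∫⁻ x, f x ∂(expMeasure μ) := by
  have hm : Measurable (exponentialPDF μ) := (measurable_exponentialPDFReal μ).ennreal_ofReal
  have hm' : Measurable (fun x => if c ≤ x then f (x - c) else 0) :=
    Measurable.ite measurableSet_Ici (by fun_prop) (by fun_prop)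
  rw [lintegral_expMeasure μ hm', lintegral_expMeasure μ hf,
    ← lintegral_const_mul _ (show Measurable fun x => exponentialPDF μ x * f x from hm.mul hf), ← lintegral_add_right_eq_self _ c]
  refine lintegral_congr fun x => ?_
  by_cases hx : 0 ≤ x
  · have h1 : c ≤ x + c := by linarith
    have h2 : 0 ≤ x + c := by linarith
    rw [if_pos h1, exponentialPDF_of_nonneg hx, exponentialPDF_of_nonneg h2, add_sub_cancel_right,
      ← mul_assoc, ← ENNReal.ofReal_mul (Real.exp_pos _).le]
    congr 2
    rw [show -(μ * (x + c)) = -(μ * c) + -(μ * x) by ring, Real.exp_add]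
    ring
  · have h1 : ¬ c ≤ x + c := by linarith
    rw [if_neg h1, exponentialPDF_of_neg (not_le.1 hx)]
    simp

section Law

variable {μ : ℝ}

theorem isProbabilityMeasure_serviceLaw (hμ : 0 < μ) : IsProbabilityMeasure (serviceLaw μ) := by
  have := isProbabilityMeasure_expMeasure hμ
  unfold serviceLaw
  infer_instance

/-- The product measure is determined on finite cylinders. Enlarging the index set to `range (n +
1)` makes coordinate `0` present, so that it can be split off. This is what allows conditioning on
the first service time in the inductions below. -/
theorem map_consSeq_serviceLaw (hμ : 0 < μ) :
    ((expMeasure μ).prod (serviceLaw μ)).map (fun p => consSeq p.1 p.2) = serviceLaw μ := by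
  have := isProbabilityMeasure_expMeasure hμ
  have := isProbabilityMeasure_serviceLaw hμ
  refine Measure.eq_infinitePi _ fun S t ht => ?_
  classical
  let t' : ℕ → Set ℝ := fun i => if i ∈ S then t i else Set.univ
  have ht' : ∀ i, MeasurableSet (t' i) := by
    intro i
    by_cases hi : i ∈ S
    · simpa [t', hi] using ht i
    · simp [t', hi]
  obtain ⟨n, hn⟩ := S.exists_nat_subset_range
  have e1 : (S : Set ℕ).pi t = ((Finset.range (n + 1) : Finset ℕ) : Set ℕ).pi t' := by
    ext s
    simp only [Set.mem_pi, Finset.mem_coe]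
    constructor
    · intro hs i _
      by_cases hi : i ∈ S
      · simpa [t', hi] using hs i hi
      · simp [t', hi]
    · intro hs i hi
      have := hs i (Finset.range_mono (Nat.le_succ n) (hn hi))
      simpa [t', hi] using this
  have e2 : ∏ i ∈ S, expMeasure μ (t i) = ∏ i ∈ Finset.range (n + 1), expMeasure μ (t' i) := by
    rw [← Finset.prod_subset (hn.trans (Finset.range_mono (Nat.le_succ n)))]
    · exact Finset.prod_congr rfl fun i hi => by simp [t', hi]
    · intro i _ hi
      simp [t', hi]
  have e3 : (fun p : ℝ × (ℕ → ℝ) => consSeq p.1 p.2) ⁻¹'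
      (((Finset.range (n + 1) : Finset ℕ) : Set ℕ).pi t')
      = t' 0 ×ˢ (((Finset.range n : Finset ℕ) : Set ℕ).pi fun i => t' (i + 1)) := by
    ext ⟨x, s⟩
    simp only [Set.mem_preimage, Set.mem_pi, Finset.mem_coe, Finset.mem_range, Set.mem_prod]
    constructor
    · intro hs
      exact ⟨hs 0 (by omega), fun i hi => hs (i + 1) (by omega)⟩
    · rintro ⟨h0, h1⟩ i hi
      cases i with
      | zero => exact h0
      | succ i => exact h1 i (by omega)
  rw [e1, e2, Measure.map_apply measurable_consSeq
    (MeasurableSet.pi (Finset.countable_toSet _) fun i _ => ht' i), e3, Measure.prod_prod,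
    Finset.prod_range_succ', mul_comm, serviceLaw, Measure.infinitePi_pi _ fun i _ => ht' _]

theorem lintegral_serviceLaw (hμ : 0 < μ) {f : (ℕ → ℝ) → ENNReal} (hf : Measurable f) :
    ∫⁻ s, f s ∂(serviceLaw μ)
      = ∫⁻ x, ∫⁻ s, f (consSeq x s) ∂(serviceLaw μ) ∂(expMeasure μ) := by
  have := isProbabilityMeasure_serviceLaw hμ
  conv_lhs => rw [← map_consSeq_serviceLaw hμ]
  have hm : Measurable fun p : ℝ × (ℕ → ℝ) => f (consSeq p.1 p.2) := hf.comp measurable_consSeq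
  rw [lintegral_map hf measurable_consSeq, lintegral_prod _ hm.aemeasurable]

theorem ae_pos_serviceLaw (hμ : 0 < μ) : ∀ᵐ s ∂(serviceLaw μ), ∀ i, 0 < s i := by
  have := isProbabilityMeasure_expMeasure hμ
  rw [ae_all_iff]
  intro i
  exact (measurePreserving_eval_infinitePi (fun _ : ℕ => expMeasure μ) i).quasiMeasurePreserving.ae
    (ae_pos_expMeasure μ)

/-- The indicator that exactly `n` receptions take place before time `T`. -/
def slot (n : ℕ) (T : ℝ) (s : ℕ → ℝ) : ENNReal :=
  if genTime s n < T ∧ T ≤ genTime s (n + 1) then 1 else 0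

@[fun_prop]
theorem measurable_slot (n : ℕ) (T : ℝ) : Measurable (slot n T) := by
  unfold slot
  refine Measurable.ite ?_ measurable_const measurable_const
  exact (measurableSet_lt (measurable_genTime n) measurable_const).inter
    (measurableSet_le measurable_const (measurable_genTime (n + 1)))

theorem slot_consSeq_succ (n : ℕ) (T x : ℝ) (s : ℕ → ℝ) :
    slot (n + 1) T (consSeq x s) = slot n (T - x) s := by
  unfold slot
  rw [genTime_consSeq, genTime_consSeq]
  congr 1
  rw [lt_sub_iff_add_lt', sub_le_iff_le_add']

/-- The service times seen from time `T` on, if exactly `n` receptions take place before. -/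
def residualSeq (n : ℕ) (T : ℝ) (s : ℕ → ℝ) : ℕ → ℝ :=
  consSeq (genTime s (n + 1) - T) (fun i => s (n + 1 + i))

@[fun_prop]
theorem measurable_residualSeq (n : ℕ) (T : ℝ) : Measurable (residualSeq n T) := by
  have h : Measurable (fun s : ℕ → ℝ => (genTime s (n + 1) - T, fun i => s (n + 1 + i))) := by
    fun_prop
  exact measurable_consSeq.comp h

theorem residualSeq_consSeq_succ (n : ℕ) (T x : ℝ) (s : ℕ → ℝ) :
    residualSeq (n + 1) T (consSeq x s) = residualSeq n (T - x) s := by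
  unfold residualSeq
  congr 1
  · rw [genTime_consSeq]; ring
  · funext i
    rw [show n + 1 + 1 + i = (n + 1 + i) + 1 by ring, consSeq_succ]

theorem residualSeq_consSeq_zero (T x : ℝ) (s : ℕ → ℝ) :
    residualSeq 0 T (consSeq x s) = consSeq (x - T) s := by
  unfold residualSeq
  congr 1
  · rw [genTime_consSeq]; simp
  · funext i
    rw [show 0 + 1 + i = i + 1 by ring, consSeq_succ]

/-- Given the first `n` service times and that the next one straddles `T`, the service times seen
from `T` on again have the law `serviceLaw μ`. -/
theorem lintegral_slot_residualSeq (hμ : 0 < μ) (n : ℕ) : ∀ (T : ℝ) (h : (ℕ → ℝ) → ENNReal),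
    Measurable h → (∀ s s' : ℕ → ℝ, (∀ i < n, s i = s' i) → h s = h s') →
    ∀ f : (ℕ → ℝ) → ENNReal, Measurable f →
    ∫⁻ s, h s * slot n T s * f (residualSeq n T s) ∂(serviceLaw μ)
      = (∫⁻ s, h s * slot n T s ∂(serviceLaw μ)) * ∫⁻ s, f s ∂(serviceLaw μ) := by
  have := isProbabilityMeasure_expMeasure hμ
  have := isProbabilityMeasure_serviceLaw hμ
  induction n with
  | zero =>
    intro T h hh hdep f hf
    have hc : ∀ s, h s = h 0 := fun s => hdep s 0 (by omega)
    rcases le_or_gt T 0 with hT | hT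
    · have hz : ∀ s, slot 0 T s = 0 := fun s => by simp [slot, not_lt.2 hT]
      simp [hz]
    -- Proved for every `f`, because the case `f = 1` then evaluates the first factor on the
    -- right-hand side. Here `h` depends on no coordinate, so it is a constant.
    · have key : ∀ f : (ℕ → ℝ) → ENNReal, Measurable f →
          ∫⁻ s, h s * slot 0 T s * f (residualSeq 0 T s) ∂(serviceLaw μ)
          = h 0 * ENNReal.ofReal (Real.exp (-(μ * T))) * ∫⁻ s, f s ∂(serviceLaw μ) := by
        intro f hf
        have hG : Measurable (fun x => ∫⁻ s, f (consSeq x s) ∂(serviceLaw μ)) :=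
          Measurable.lintegral_prod_right' (f := fun p : ℝ × (ℕ → ℝ) => f (consSeq p.1 p.2))
            (hf.comp measurable_consSeq)
        rw [lintegral_serviceLaw hμ (by fun_prop), lintegral_serviceLaw hμ hf, mul_assoc,
          ← lintegral_expMeasure_shift μ hT.le hG, ← lintegral_const_mul]
        · refine lintegral_congr fun x => ?_
          have : ∀ s, h (consSeq x s) * slot 0 T (consSeq x s) * f (residualSeq 0 T (consSeq x s))
              = h 0 * (if T ≤ x then f (consSeq (x - T) s) else 0) := by
            intro s
            rw [residualSeq_consSeq_zero, hc, slot, genTime_consSeq]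
            simp only [genTime_zero, add_zero, hT, true_and, mul_assoc]
            split_ifs <;> simp
          simp_rw [this]
          by_cases hx : T ≤ x
          · simp only [hx, if_true]
            exact lintegral_const_mul _ (hf.comp (measurable_consSeq_right _))
          · simp [hx]
        · exact Measurable.ite measurableSet_Ici (by fun_prop) (by fun_prop)
      rw [key f hf]
      have h1 := key (fun _ => 1) measurable_const
      simp only [mul_one, lintegral_const, measure_univ] at h1
      rw [h1]
  | succ n ih =>
    intro T h hh hdep f hf
    rw [lintegral_serviceLaw hμ (by fun_prop), lintegral_serviceLaw hμ (f := fun s => h s * _)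
      (by fun_prop), ← lintegral_mul_const]
    -- Given the first service time `x`, the claim for `n + 1` and `T` is that for `n` and `T - x`.
    -- The latter may be negative, so the induction has to run over all real `T`.
    · refine lintegral_congr fun x => ?_
      simp_rw [residualSeq_consSeq_succ, slot_consSeq_succ]
      refine ih (T - x) (fun s => h (consSeq x s)) (hh.comp (measurable_consSeq_right x))
        (fun s s' hs => hdep _ _ fun i hi => ?_) f hf
      cases i with
      | zero => rfl
      | succ i => exact hs i (by omega)
    · exact Measurable.lintegral_prod_right'
        (f := fun p : ℝ × (ℕ → ℝ) => h (consSeq p.1 p.2) * slot (n + 1) T (consSeq p.1 p.2))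
        ((hh.comp measurable_consSeq).mul ((measurable_slot _ _).comp measurable_consSeq))

/-- Moments of the time since the last reception before `T`, on the event that exactly `n`
receptions take place before `T`. -/
theorem lintegral_slot_pow (hμ : 0 < μ) (k n : ℕ) : ∀ T : ℝ,
    ∫⁻ s, ENNReal.ofReal ((T - genTime s n) ^ k / k.factorial) * slot n T s ∂(serviceLaw μ)
      = if 0 < T then ENNReal.ofReal
          (μ ^ n * (T ^ (n + k) / (n + k).factorial) * Real.exp (-(μ * T))) else 0 := by
  have := isProbabilityMeasure_expMeasure hμ
  have := isProbabilityMeasure_serviceLaw hμ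
  induction n with
  | zero =>
    intro T
    split_ifs with hT
    · have h1 := lintegral_expMeasure_shift μ hT.le (f := fun _ => 1) measurable_const
      simp only [lintegral_const, measure_univ, mul_one] at h1
      rw [lintegral_serviceLaw hμ (by fun_prop)]
      have : ∀ x s, ENNReal.ofReal ((T - genTime (consSeq x s) 0) ^ k / k.factorial) *
          slot 0 T (consSeq x s)
          = ENNReal.ofReal (T ^ k / k.factorial) * (if T ≤ x then 1 else 0) := by
        intro x s
        simp [slot, genTime_consSeq, hT]
      simp_rw [this, lintegral_const, measure_univ, mul_one]
      rw [lintegral_const_mul _ (Measurable.ite measurableSet_Ici (by fun_prop) (by fun_prop)), h1,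
        ← ENNReal.ofReal_mul (by positivity)]
      simp
    · simp [slot, hT]
  | succ n ih =>
    intro T
    rw [lintegral_serviceLaw hμ (by fun_prop)]
    simp_rw [slot_consSeq_succ, genTime_consSeq, ← sub_sub, ih]
    have hm : Measurable fun x => if 0 < T - x then ENNReal.ofReal
        (μ ^ n * ((T - x) ^ (n + k) / (n + k).factorial) * Real.exp (-(μ * (T - x)))) else 0 :=
      Measurable.ite (measurableSet_lt measurable_const (by fun_prop)) (by fun_prop) (by fun_prop)
    rw [lintegral_expMeasure μ hm]
    -- The factors `exp (-μx)` and `exp (-μ(T - x))` combine to the constant `exp (-μT)`, leaving a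
    -- polynomial to integrate over `[0, T)`.
    have hpt : ∀ x, exponentialPDF μ x * (if 0 < T - x then ENNReal.ofReal
        (μ ^ n * ((T - x) ^ (n + k) / (n + k).factorial) * Real.exp (-(μ * (T - x)))) else 0)
        = (Set.Ico 0 T).indicator (fun x => ENNReal.ofReal
          (μ ^ (n + 1) * Real.exp (-(μ * T)) / (n + k).factorial * (T - x) ^ (n + k))) x := by
      intro x
      by_cases hx0 : 0 ≤ x
      · by_cases hxT : x < T
        · rw [if_pos (sub_pos.2 hxT), Set.indicator_of_mem (show x ∈ Set.Ico 0 T from ⟨hx0, hxT⟩),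
            exponentialPDF_of_nonneg hx0, ← ENNReal.ofReal_mul (by positivity)]
          congr 1
          rw [show -(μ * T) = -(μ * x) + -(μ * (T - x)) by ring, Real.exp_add]
          ring
        · rw [if_neg (by linarith), Set.indicator_of_notMem (fun h => hxT h.2), mul_zero]
      · rw [exponentialPDF_of_neg (not_le.1 hx0), Set.indicator_of_notMem (fun h => hx0 h.1),
          zero_mul]
    simp_rw [hpt]
    rw [lintegral_indicator measurableSet_Ico]
    split_ifs with hT
    · have hcont : Continuous fun x : ℝ =>
          μ ^ (n + 1) * Real.exp (-(μ * T)) / (n + k).factorial * (T - x) ^ (n + k) := by fun_prop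
      rw [← ofReal_integral_eq_lintegral_ofReal]
      · congr 1
        rw [integral_Ico_eq_integral_Ioc, ← intervalIntegral.integral_of_le hT.le,
          intervalIntegral.integral_const_mul,
          intervalIntegral.integral_comp_sub_left (fun x => x ^ (n + k)) T, integral_pow]
        rw [show n + 1 + k = (n + k) + 1 by ring, Nat.factorial_succ]
        push_cast
        have : ((n + k).factorial : ℝ) ≠ 0 := by positivity
        have : (n : ℝ) + k + 1 ≠ 0 := by positivity
        simp only [sub_self, sub_zero, ne_eq, Nat.add_eq_zero_iff, one_ne_zero, and_false,
          not_false_eq_true, zero_pow]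
        field_simp
      · exact (hcont.integrableOn_Icc).mono_set Set.Ico_subset_Icc_self
      · refine (ae_restrict_iff' measurableSet_Ico).2 (Eventually.of_forall fun x hx => ?_)
        have : 0 ≤ T - x := by linarith [hx.2]
        simp only [Pi.zero_apply]
        positivity
    · rw [Set.Ico_eq_empty (by linarith)]
      simp

end Law

/-! ### Receptions in one window and the residual service times -/

/-- The number of receptions before time `T`. -/
def recvCount (T : ℝ) (s : ℕ → ℝ) : ℕ := sInf {n | T ≤ genTime s (n + 1)}

@[fun_prop]
theorem measurable_recvCount (T : ℝ) : Measurable (recvCount T) := by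
  refine measurable_to_countable' fun n => ?_
  have hle : ∀ m, MeasurableSet {s : ℕ → ℝ | T ≤ genTime s (m + 1)} := fun m =>
    measurableSet_le measurable_const (measurable_genTime (m + 1))
  -- The second piece accounts for the default `sInf ∅ = 0`.
  have e : recvCount T ⁻¹' {n} =
      ({s | T ≤ genTime s (n + 1)} ∩ ⋂ m ∈ Finset.range n, {s | T ≤ genTime s (m + 1)}ᶜ)
        ∪ ((⋂ m, {s | T ≤ genTime s (m + 1)}ᶜ) ∩ {_s | n = 0}) := by
    ext s
    simp only [recvCount, Set.mem_preimage, Set.mem_singleton_iff, Set.mem_union, Set.mem_inter_iff,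
      Set.mem_ofPred_eq, Set.mem_iInter, Set.mem_compl_iff, Finset.mem_range]
    constructor
    · intro h
      rcases Set.eq_empty_or_nonempty {n | T ≤ genTime s (n + 1)} with he | hne
      · right
        refine ⟨fun m hm => ?_, ?_⟩
        · have : m ∈ {n | T ≤ genTime s (n + 1)} := hm
          rw [he] at this
          exact this
        · rw [← h, he, Nat.sInf_empty]
      · left
        refine ⟨?_, fun m hm hm' => ?_⟩
        · have := Nat.sInf_mem hne
          rw [h] at this
          exact this
        · rw [← h] at hm
          exact Nat.notMem_of_lt_sInf hm hm'
    · rintro (⟨h1, h2⟩ | ⟨h1, h2⟩)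
      · refine le_antisymm (Nat.sInf_le h1) (not_lt.1 fun hlt => ?_)
        exact h2 _ hlt (Nat.sInf_mem (s := {n | T ≤ genTime s (n + 1)}) ⟨n, h1⟩)
      · have : {n | T ≤ genTime s (n + 1)} = ∅ := Set.eq_empty_of_forall_notMem h1
        rw [this, h2, Nat.sInf_empty]
  rw [e]
  refine ((hle n).inter (MeasurableSet.biInter (Finset.countable_toSet _)
    fun m _ => (hle m).compl)).union ((MeasurableSet.iInter fun m => (hle m).compl).inter ?_)
  exact MeasurableSet.const _

theorem genTime_strictMono {s : ℕ → ℝ} (hs : ∀ i, 0 < s i) : StrictMono (genTime s) :=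
  strictMono_nat_of_lt_succ fun n => by
    rw [genTime_succ]
    linarith [hs n]

theorem le_genTime_recvCount_succ {T : ℝ} {s : ℕ → ℝ} (hex : ∃ n, T ≤ genTime s (n + 1)) :
    T ≤ genTime s (recvCount T s + 1) :=
  Nat.sInf_mem (s := {n | T ≤ genTime s (n + 1)}) hex

/-- No existence hypothesis is needed: if no reception time reaches `T`, the count is `0` by default
and `genTime s 0 = 0 < T`. -/
theorem genTime_recvCount_lt {T : ℝ} (hT : 0 < T) {s : ℕ → ℝ} :
    genTime s (recvCount T s) < T := by
  rcases Nat.eq_zero_or_pos (recvCount T s) with h | h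
  · rw [h]
    simpa using hT
  · have hlt : recvCount T s - 1 < sInf {n | T ≤ genTime s (n + 1)} := by
      change _ < recvCount T s
      omega
    have := Nat.notMem_of_lt_sInf hlt
    rw [Set.mem_ofPred_eq, Nat.sub_add_cancel h, not_le] at this
    exact this

theorem slot_eq_ite {T : ℝ} (hT : 0 < T) {s : ℕ → ℝ} (hs : ∀ i, 0 < s i)
    (hex : ∃ n, T ≤ genTime s (n + 1)) (n : ℕ) :
    slot n T s = if n = recvCount T s then 1 else 0 := by
  unfold slot
  congr 1
  have hm := genTime_strictMono hs
  have h1 := genTime_recvCount_lt hT (s := s)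
  have h2 := le_genTime_recvCount_succ hex
  refine propext ⟨fun ⟨h3, h4⟩ => ?_, fun h => by subst h; exact ⟨h1, h2⟩⟩
  have a := hm.lt_iff_lt.1 (h3.trans_le h2)
  have b := hm.lt_iff_lt.1 (h1.trans_le h4)
  omega

/-- The number of receptions in the window `(0, T)`, and the times of the first, of the last and of
the last but one of them (`0` if there is none). -/
def windowAt (n : ℕ) (s : ℕ → ℝ) : ℕ × ℝ × ℝ × ℝ :=
  (n, genTime s (min 1 n), genTime s n, genTime s (n - 1))

@[fun_prop]
theorem measurable_windowAt (n : ℕ) : Measurable (windowAt n) := by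
  unfold windowAt
  fun_prop

/-- The observation of the window `(0, T)`. -/
def window (T : ℝ) (s : ℕ → ℝ) : ℕ × ℝ × ℝ × ℝ := windowAt (recvCount T s) s

@[fun_prop]
theorem measurable_window (T : ℝ) : Measurable (window T) := by
  have : Measurable fun p : ℕ × (ℕ → ℝ) => windowAt p.1 p.2 :=
    measurable_from_prod_countable_right fun n => measurable_windowAt n
  exact this.comp ((measurable_recvCount T).prodMk measurable_id)

/-- The service times seen from time `T` on. -/
def cutSeq (T : ℝ) (s : ℕ → ℝ) : ℕ → ℝ := residualSeq (recvCount T s) T s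

@[fun_prop]
theorem measurable_cutSeq (T : ℝ) : Measurable (cutSeq T) := by
  have : Measurable fun p : ℕ × (ℕ → ℝ) => residualSeq p.1 T p.2 :=
    measurable_from_prod_countable_right fun n => measurable_residualSeq n T
  exact this.comp ((measurable_recvCount T).prodMk measurable_id)

/-! ### Independence of a window and its future -/

section Law

variable {μ T : ℝ}

theorem lintegral_slot (hμ : 0 < μ) (hT : 0 < T) (n : ℕ) :
    ∫⁻ s, slot n T s ∂(serviceLaw μ)
      = ENNReal.ofReal ((μ * T) ^ n / n.factorial * Real.exp (-(μ * T))) := by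
  have := lintegral_slot_pow hμ 0 n T
  simp only [pow_zero, Nat.factorial_zero, Nat.cast_one, div_one, ENNReal.ofReal_one, one_mul,
    if_pos hT, add_zero] at this
  rw [this, mul_pow]
  congr 1
  ring

theorem hasSum_poisson (x : ℝ) :
    HasSum (fun n : ℕ => x ^ n / n.factorial * Real.exp (-x)) 1 := by
  have h := (NormedSpace.expSeries_div_hasSum_exp x).mul_right (Real.exp (-x))
  rw [← Real.exp_eq_exp_ℝ, ← Real.exp_add] at h
  simpa using h

/-- The Poisson weights of the events "exactly `n` receptions before `T`" already sum to `1`,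
leaving no mass for infinitely many receptions before `T`. -/
theorem ae_exists_le_genTime (hμ : 0 < μ) (hT : 0 < T) :
    ∀ᵐ s ∂(serviceLaw μ), ∃ n, T ≤ genTime s (n + 1) := by
  have := isProbabilityMeasure_serviceLaw hμ
  have hmeas : MeasurableSet {s : ℕ → ℝ | ∃ n, T ≤ genTime s (n + 1)} := by
    rw [Set.ofPred_exists]
    exact MeasurableSet.iUnion fun n => measurableSet_le measurable_const (measurable_genTime _)
  have h1 : ∫⁻ s, ∑' n, slot n T s ∂(serviceLaw μ) = 1 := by
    rw [lintegral_tsum fun n => (measurable_slot n T).aemeasurable]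
    simp_rw [lintegral_slot hμ hT]
    rw [← ENNReal.ofReal_tsum_of_nonneg (fun n => by positivity) (hasSum_poisson _).summable,
      (hasSum_poisson _).tsum_eq, ENNReal.ofReal_one]
  have h2 : ∫⁻ s, ∑' n, slot n T s ∂(serviceLaw μ)
      = ∫⁻ s, Set.indicator {s : ℕ → ℝ | ∃ n, T ≤ genTime s (n + 1)} 1 s ∂(serviceLaw μ) := by
    refine lintegral_congr_ae ?_
    filter_upwards [ae_pos_serviceLaw hμ] with s hs
    by_cases hex : ∃ n, T ≤ genTime s (n + 1)
    · rw [Set.indicator_of_mem (by exact hex)]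
      simp_rw [slot_eq_ite hT hs hex]
      simp
    · rw [Set.indicator_of_notMem (by exact hex)]
      push Not at hex
      simp [slot, not_le.2 (hex _)]
  rw [h1, lintegral_indicator_one hmeas] at h2
  exact (mem_ae_iff_prob_eq_one hmeas).2 h2.symm

/-- Integrals over the number of receptions before time `T`. -/
theorem lintegral_eq_tsum_slot (hμ : 0 < μ) (hT : 0 < T) {F : ℕ → (ℕ → ℝ) → ENNReal}
    (hF : ∀ n, Measurable (F n)) :
    ∫⁻ s, F (recvCount T s) s ∂(serviceLaw μ)
      = ∑' n, ∫⁻ s, F n s * slot n T s ∂(serviceLaw μ) := by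
  have hm : ∀ n, Measurable fun s => F n s * slot n T s := fun n =>
    (hF n).mul (measurable_slot n T)
  rw [← lintegral_tsum fun n => (hm n).aemeasurable]
  refine lintegral_congr_ae ?_
  filter_upwards [ae_pos_serviceLaw hμ, ae_exists_le_genTime hμ hT] with s hs hex
  simp_rw [slot_eq_ite hT hs hex]
  rw [tsum_eq_single (recvCount T s)]
  · simp
  · intro n hn
    simp [hn]

/-- Split according to the number `n` of receptions. On each piece the observation depends only on
the first `n` service times, as `lintegral_slot_residualSeq` requires. -/
theorem lintegral_window_cutSeq (hμ : 0 < μ) (hT : 0 < T) {φ : ℕ × ℝ × ℝ × ℝ → ENNReal}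
    (hφ : Measurable φ) {f : (ℕ → ℝ) → ENNReal} (hf : Measurable f) :
    ∫⁻ s, φ (window T s) * f (cutSeq T s) ∂(serviceLaw μ)
      = (∫⁻ s, φ (window T s) ∂(serviceLaw μ)) * ∫⁻ s, f s ∂(serviceLaw μ) := by
  have h1 := lintegral_eq_tsum_slot hμ hT
    (F := fun n s => φ (windowAt n s) * f (residualSeq n T s)) (fun n => by fun_prop)
  have h2 := lintegral_eq_tsum_slot hμ hT (F := fun n s => φ (windowAt n s)) (fun n => by fun_prop)
  have h1' : ∫⁻ s, φ (window T s) * f (cutSeq T s) ∂(serviceLaw μ) = _ := h1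
  have h2' : ∫⁻ s, φ (window T s) ∂(serviceLaw μ) = _ := h2
  rw [h1', h2', ← ENNReal.tsum_mul_right]
  refine tsum_congr fun n => ?_
  rw [← lintegral_slot_residualSeq hμ n T (fun s => φ (windowAt n s)) (by fun_prop) _ f hf]
  · refine lintegral_congr fun s => ?_
    ring
  · intro s s' h
    unfold windowAt
    rw [genTime_congr h le_rfl, genTime_congr h (Nat.sub_le n 1), genTime_congr h (min_le_right 1 n)]

/-- The observation of the window `(0, T)` is independent of what is seen from `T` on. -/
theorem measure_window_inter_cutSeq (hμ : 0 < μ) (hT : 0 < T) (A : Set (ℕ × ℝ × ℝ × ℝ))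
    (B : Set (ℕ → ℝ)) (hA : MeasurableSet A) (hB : MeasurableSet B) :
    serviceLaw μ (window T ⁻¹' A ∩ cutSeq T ⁻¹' B)
      = serviceLaw μ (window T ⁻¹' A) * serviceLaw μ B := by
  have h := lintegral_window_cutSeq hμ hT (φ := A.indicator 1) (f := B.indicator 1)
    (measurable_one.indicator hA) (measurable_one.indicator hB)
  have mA := measurable_window T hA
  have mB := measurable_cutSeq T hB
  have e : ∫⁻ s, (window T ⁻¹' A ∩ cutSeq T ⁻¹' B).indicator 1 s ∂(serviceLaw μ)
      = ∫⁻ s, A.indicator 1 (window T s) * B.indicator 1 (cutSeq T s) ∂(serviceLaw μ) := by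
    refine lintegral_congr fun s => ?_
    rw [Set.inter_indicator_one]
    rfl
  rw [← lintegral_indicator_one (mA.inter mB), ← lintegral_indicator_one mA,
    ← lintegral_indicator_one hB, e, h]
  rfl

theorem measurePreserving_cutSeq (hμ : 0 < μ) (hT : 0 < T) :
    MeasurePreserving (cutSeq T) (serviceLaw μ) (serviceLaw μ) := by
  have := isProbabilityMeasure_serviceLaw hμ
  exact measurePreserving_of_regenerative (measurable_cutSeq T) (measure_window_inter_cutSeq hμ hT)

/-- Almost surely, what is seen from each multiple of `T` on consists of positive service times and
has a reception after any further delay `T`. -/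
theorem ae_forall_iterate_cutSeq (hμ : 0 < μ) (hT : 0 < T) :
    ∀ᵐ s ∂(serviceLaw μ), ∀ j, (∀ i, 0 < (cutSeq T)^[j] s i) ∧
      ∃ n, T ≤ genTime ((cutSeq T)^[j] s) (n + 1) := by
  rw [ae_all_iff]
  intro j
  refine ((measurePreserving_cutSeq hμ hT).iterate j).quasiMeasurePreserving.ae
    (p := fun s => (∀ i, 0 < s i) ∧ ∃ n, T ≤ genTime s (n + 1)) ?_
  exact (ae_pos_serviceLaw hμ).and (ae_exists_le_genTime hμ hT)

end Law

/-! ### Moments of the window -/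

theorem integrable_and_integral_of_lintegral {α : Type*} [MeasurableSpace α] {ν : Measure α}
    {f : α → ℝ} (hf : Measurable f) (h0 : ∀ᵐ a ∂ν, 0 ≤ f a) {m : ℝ} (hm : 0 ≤ m)
    (h : ∫⁻ a, ENNReal.ofReal (f a) ∂ν = ENNReal.ofReal m) :
    Integrable f ν ∧ ∫ a, f a ∂ν = m := by
  refine ⟨⟨hf.aestronglyMeasurable, ?_⟩, ?_⟩
  · rw [hasFiniteIntegral_iff_ofReal h0, h]
    exact ENNReal.ofReal_lt_top
  · rw [integral_eq_lintegral_of_nonneg_ae h0 hf.aestronglyMeasurable, h, ENNReal.toReal_ofReal hm]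

theorem lintegral_Ioo_mul_exp {μ T : ℝ} (hμ : 0 < μ) (hT : 0 < T) :
    ∫⁻ x in Set.Ioo 0 T, ENNReal.ofReal (μ * Real.exp (-(μ * x)) * x)
      = ENNReal.ofReal ((1 - Real.exp (-(μ * T)) - μ * T * Real.exp (-(μ * T))) / μ) := by
  have hcont : Continuous fun x : ℝ => μ * Real.exp (-(μ * x)) * x := by fun_prop
  rw [← ofReal_integral_eq_lintegral_ofReal]
  · congr 1
    rw [← integral_Ioc_eq_integral_Ioo, ← intervalIntegral.integral_of_le hT.le]
    have hd : ∀ x ∈ Set.uIcc 0 T, HasDerivAt (fun x => -(x + 1 / μ) * Real.exp (-(μ * x)))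
        (μ * Real.exp (-(μ * x)) * x) x := by
      intro x _
      have h1 : HasDerivAt (fun x => -(μ * x)) (-(μ * 1)) x := ((hasDerivAt_id x).const_mul μ).neg
      have h2 : HasDerivAt (fun x => -(x + 1 / μ)) (-1) x := ((hasDerivAt_id x).add_const _).neg
      convert! h2.mul h1.exp using 1
      field_simp
      ring
    rw [intervalIntegral.integral_eq_sub_of_hasDerivAt hd (hcont.intervalIntegrable _ _)]
    simp only [mul_zero, neg_zero, Real.exp_zero]
    field_simp
    ring
  · exact hcont.integrableOn_Icc.mono_set Set.Ioo_subset_Icc_self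
  · refine (ae_restrict_iff' measurableSet_Ioo).2 (Eventually.of_forall fun x hx => ?_)
    have := hx.1
    simp only [Pi.zero_apply]
    positivity

section Moments

variable {μ T : ℝ}

/-- The number of receptions in a window is Poisson distributed. -/
theorem integral_recvCount (hμ : 0 < μ) (hT : 0 < T) {c : ℕ → ℝ} (hc : ∀ n, 0 ≤ c n) {m : ℝ}
    (h : HasSum (fun n => c n * ((μ * T) ^ n / n.factorial * Real.exp (-(μ * T)))) m) :
    Integrable (fun s => c (window T s).1) (serviceLaw μ) ∧
      ∫ s, c (window T s).1 ∂(serviceLaw μ) = m := by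
  have hnn : ∀ n : ℕ, 0 ≤ c n * ((μ * T) ^ n / n.factorial * Real.exp (-(μ * T))) := fun n =>
    mul_nonneg (hc n) (by positivity)
  refine integrable_and_integral_of_lintegral
    ((measurable_of_countable c).comp (measurable_window T).fst)
    (Eventually.of_forall fun s => hc _) (h.nonneg hnn) ?_
  have h1 := lintegral_eq_tsum_slot hμ hT (F := fun n _ => ENNReal.ofReal (c n))
    fun n => measurable_const
  refine h1.trans ?_
  rw [← h.tsum_eq, ENNReal.ofReal_tsum_of_nonneg hnn h.summable]
  refine tsum_congr fun n => ?_
  rw [lintegral_const_mul _ (measurable_slot n T), lintegral_slot hμ hT,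
    ← ENNReal.ofReal_mul (hc n)]

theorem integral_recvCount_eq (hμ : 0 < μ) (hT : 0 < T) (k : ℕ) :
    Integrable (fun s => if (window T s).1 = k then (1 : ℝ) else 0) (serviceLaw μ) ∧
      ∫ s, (if (window T s).1 = k then (1 : ℝ) else 0) ∂(serviceLaw μ)
        = (μ * T) ^ k / k.factorial * Real.exp (-(μ * T)) := by
  refine integral_recvCount hμ hT (c := fun n => if n = k then 1 else 0)
    (fun n => by split_ifs <;> norm_num) ?_
  convert hasSum_ite_eq k ((μ * T) ^ k / k.factorial * Real.exp (-(μ * T))) using 1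
  funext n
  split_ifs with h
  · simp [h]
  · simp

theorem integral_recvCount_cast (hμ : 0 < μ) (hT : 0 < T) :
    Integrable (fun s => ((window T s).1 : ℝ)) (serviceLaw μ) ∧
      ∫ s, ((window T s).1 : ℝ) ∂(serviceLaw μ) = μ * T := by
  refine integral_recvCount hμ hT (c := fun n => (n : ℝ)) (fun n => by positivity) ?_
  rw [← hasSum_nat_add_iff' 1]
  have e : ∀ n : ℕ, ((n + 1 : ℕ) : ℝ) *
      ((μ * T) ^ (n + 1) / (n + 1).factorial * Real.exp (-(μ * T)))
      = μ * T * ((μ * T) ^ n / n.factorial * Real.exp (-(μ * T))) := by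
    intro n
    rw [Nat.factorial_succ]
    push_cast
    have : (n : ℝ) + 1 ≠ 0 := by positivity
    field_simp
    ring
  simp_rw [e]
  simpa using (hasSum_poisson (μ * T)).mul_left (μ * T)

/-- On the event of `n` receptions, the elapsed time `T - L` since the last one, `L`, contributes
`μ⁻¹` times the Poisson weight of `n + 1`. Summing gives `μ⁻¹` times the Poisson mass of the
positive integers. -/
theorem integral_windowLast (hμ : 0 < μ) (hT : 0 < T) :
    Integrable (fun s => (window T s).2.2.1) (serviceLaw μ) ∧
      ∫ s, (window T s).2.2.1 ∂(serviceLaw μ) = T - (1 - Real.exp (-(μ * T))) / μ := by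
  have := isProbabilityMeasure_serviceLaw hμ
  have hq : Real.exp (-(μ * T)) ≤ 1 := Real.exp_le_one_iff.2 (by nlinarith)
  have key : Integrable (fun s => T - (window T s).2.2.1) (serviceLaw μ) ∧
      ∫ s, (T - (window T s).2.2.1) ∂(serviceLaw μ) = (1 - Real.exp (-(μ * T))) / μ := by
    refine integrable_and_integral_of_lintegral (measurable_const.sub (measurable_window T).snd.snd.fst)
      (Eventually.of_forall fun s => ?_) (div_nonneg (by linarith) hμ.le) ?_
    · exact sub_nonneg.2 (genTime_recvCount_lt hT).le
    · have h1 := lintegral_eq_tsum_slot hμ hT (F := fun n s => ENNReal.ofReal (T - genTime s n))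
        fun n => by fun_prop
      refine h1.trans ?_
      have h2 : ∀ n, ∫⁻ s, ENNReal.ofReal (T - genTime s n) * slot n T s ∂(serviceLaw μ)
          = ENNReal.ofReal
            (μ⁻¹ * ((μ * T) ^ (n + 1) / (n + 1).factorial * Real.exp (-(μ * T)))) := by
        intro n
        have := lintegral_slot_pow hμ 1 n T
        simp only [pow_one, Nat.factorial_one, Nat.cast_one, div_one, if_pos hT] at this
        rw [this]
        congr 1
        field_simp
        ring
      simp_rw [h2]
      have hs := ((hasSum_nat_add_iff' 1).2 (hasSum_poisson (μ * T))).mul_left μ⁻¹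
      rw [← ENNReal.ofReal_tsum_of_nonneg (fun n => by positivity) hs.summable, hs.tsum_eq]
      congr 1
      simp
      field_simp
  have e : (fun s => (window T s).2.2.1) = fun s => T - (T - (window T s).2.2.1) := by
    funext s; ring
  rw [e]
  refine ⟨(integrable_const T).sub key.1, ?_⟩
  rw [integral_sub (integrable_const T) key.1, key.2]
  simp

/-- Almost surely the recorded value is `s 0` if `s 0 < T` and `0` otherwise, so only one
exponential variable is involved. -/
theorem integral_windowFirst (hμ : 0 < μ) (hT : 0 < T) :
    Integrable (fun s => (window T s).2.1) (serviceLaw μ) ∧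
      ∫ s, (window T s).2.1 ∂(serviceLaw μ)
        = (1 - Real.exp (-(μ * T)) - μ * T * Real.exp (-(μ * T))) / μ := by
  have hp := isProbabilityMeasure_expMeasure hμ
  have hval : ∀ᵐ s ∂(serviceLaw μ), (window T s).2.1 = if s 0 < T then s 0 else 0 := by
    filter_upwards [ae_pos_serviceLaw hμ, ae_exists_le_genTime hμ hT] with s hs hex
    have hm := genTime_strictMono hs
    have hg1 : genTime s 1 = s 0 := by simp [genTime]
    have h1 := genTime_recvCount_lt hT (s := s)
    have h2 := le_genTime_recvCount_succ hex
    change genTime s (min 1 (recvCount T s)) = _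
    split_ifs with h
    · have : 0 < recvCount T s := by
        rw [← hg1] at h
        have := hm.lt_iff_lt.1 (h.trans_le h2)
        omega
      rw [min_eq_left (by omega), hg1]
    · have : recvCount T s = 0 := by
        rw [← hg1] at h
        have := hm.lt_iff_lt.1 (h1.trans_le (not_lt.1 h))
        omega
      rw [this]
      simp
  have hnn : 0 ≤ (1 - Real.exp (-(μ * T)) - μ * T * Real.exp (-(μ * T))) / μ := by
    refine div_nonneg ?_ hμ.le
    have h1 := Real.add_one_le_exp (μ * T)
    have h2 : Real.exp (μ * T) * Real.exp (-(μ * T)) = 1 := by rw [← Real.exp_add]; simp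
    nlinarith [Real.exp_pos (-(μ * T))]
  refine integrable_and_integral_of_lintegral (measurable_window T).snd.fst ?_ hnn ?_
  · filter_upwards [hval, ae_pos_serviceLaw hμ] with s hs hs'
    rw [hs]
    split_ifs
    · exact (hs' 0).le
    · exact le_rfl
  · have hmg : Measurable fun x : ℝ => ENNReal.ofReal (if x < T then x else 0) :=
      (Measurable.ite measurableSet_Iio measurable_id measurable_const).ennreal_ofReal
    have e1 : ∫⁻ s, ENNReal.ofReal (window T s).2.1 ∂(serviceLaw μ)
        = ∫⁻ x, ENNReal.ofReal (if x < T then x else 0) ∂(expMeasure μ) := by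
      rw [← (measurePreserving_eval_infinitePi (fun _ : ℕ => expMeasure μ) 0).lintegral_comp hmg]
      refine lintegral_congr_ae ?_
      filter_upwards [hval] with s hs
      rw [hs]
    rw [e1, lintegral_expMeasure μ hmg, ← lintegral_Ioo_mul_exp hμ hT,
      ← lintegral_indicator measurableSet_Ioo]
    refine lintegral_congr fun x => ?_
    by_cases hx0 : 0 < x
    · by_cases hxT : x < T
      · rw [if_pos hxT, Set.indicator_of_mem (show x ∈ Set.Ioo 0 T from ⟨hx0, hxT⟩),
          exponentialPDF_of_nonneg hx0.le, ← ENNReal.ofReal_mul (by positivity)]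
      · rw [if_neg hxT, Set.indicator_of_notMem (fun h => hxT h.2)]
        simp
    · rw [Set.indicator_of_notMem (fun h => hx0 h.1)]
      have : (if x < T then x else 0) ≤ 0 := by
        split_ifs
        · exact not_lt.1 hx0
        · exact le_rfl
      rw [ENNReal.ofReal_of_nonpos this, mul_zero]

/-- The mean is not needed: in `periodSum` this coordinate enters with opposite signs from the two
windows, and by stationarity the means cancel. -/
theorem integrable_windowPrev (hμ : 0 < μ) (hT : 0 < T) :
    Integrable (fun s => (window T s).2.2.2) (serviceLaw μ) := by
  have := isProbabilityMeasure_serviceLaw hμ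
  refine Integrable.of_bound ((measurable_window T).snd.snd.snd.aestronglyMeasurable) T ?_
  filter_upwards [ae_pos_serviceLaw hμ] with s hs
  have hm := genTime_strictMono hs
  have h0 : 0 ≤ genTime s (recvCount T s - 1) := by
    rw [← genTime_zero s]
    exact hm.monotone (Nat.zero_le _)
  change ‖genTime s (recvCount T s - 1)‖ ≤ T
  rw [Real.norm_of_nonneg h0]
  exact (hm.monotone (Nat.sub_le _ _)).trans (genTime_recvCount_lt hT).le

end Moments

/-! ### Mean number and mean sum of the peaks in a period -/

/-- The function `f` is integrable with integral `m`. -/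
def HasMean {α : Type*} [MeasurableSpace α] (ν : Measure α) (f : α → ℝ) (m : ℝ) : Prop :=
  Integrable f ν ∧ ∫ a, f a ∂ν = m

namespace HasMean

variable {α : Type*} [MeasurableSpace α] {ν : Measure α} {f g : α → ℝ} {m m' : ℝ}

theorem add (hf : HasMean ν f m) (hg : HasMean ν g m') :
    HasMean ν (fun a => f a + g a) (m + m') :=
  ⟨hf.1.add hg.1, by rw [integral_add hf.1 hg.1, hf.2, hg.2]⟩

theorem sub (hf : HasMean ν f m) (hg : HasMean ν g m') :
    HasMean ν (fun a => f a - g a) (m - m') :=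
  ⟨hf.1.sub hg.1, by rw [integral_sub hf.1 hg.1, hf.2, hg.2]⟩

theorem const_mul (c : ℝ) (hf : HasMean ν f m) : HasMean ν (fun a => c * f a) (c * m) :=
  ⟨hf.1.const_mul c, by rw [integral_const_mul, hf.2]⟩

theorem const [IsProbabilityMeasure ν] (c : ℝ) : HasMean ν (fun _ => c) c :=
  ⟨integrable_const c, by simp⟩

end HasMean

/-- The indicator that a window contains exactly `k` receptions. -/
def countIs (k : ℕ) (x : ℕ × ℝ × ℝ × ℝ) : ℝ := if x.1 = k then 1 else 0

@[fun_prop]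
theorem measurable_countIs (k : ℕ) : Measurable (countIs k) :=
  (measurable_of_countable fun n : ℕ => if n = k then (1 : ℝ) else 0).comp measurable_fst

/-- The number of peaks in a period, from the observations of the previous and of the current
period. -/
def periodCount (p : (ℕ × ℝ × ℝ × ℝ) × (ℕ × ℝ × ℝ × ℝ)) : ℝ :=
  (1 - countIs 0 p.1) * (1 - countIs 0 p.2) + p.2.1 - (1 - countIs 0 p.2) + countIs 1 p.2
    + countIs 0 p.2

/-- The sum of the peaks in a period, from the observations of the previous and of the current
period. -/
def periodSum (T : ℝ) (p : (ℕ × ℝ × ℝ × ℝ) × (ℕ × ℝ × ℝ × ℝ)) : ℝ :=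
  T * ((1 - countIs 0 p.1) * (1 - countIs 0 p.2)) + (1 - countIs 0 p.1) * p.2.2.1 - p.1.2.2.2
    + T * (1 - countIs 0 p.2) - p.1.2.2.1 * (1 - countIs 0 p.2) - p.2.2.1 + p.2.2.2.1 + p.2.2.2.2
    + T * countIs 1 p.2 + 2 * T * countIs 0 p.2

@[fun_prop]
theorem measurable_periodCount : Measurable periodCount := by
  unfold periodCount
  have : Measurable fun p : (ℕ × ℝ × ℝ × ℝ) × (ℕ × ℝ × ℝ × ℝ) => (p.2.1 : ℝ) :=
    (measurable_of_countable fun n : ℕ => (n : ℝ)).comp (by fun_prop)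
  fun_prop

@[fun_prop]
theorem measurable_periodSum (T : ℝ) : Measurable (periodSum T) := by
  unfold periodSum
  fun_prop

section Means

variable {μ T : ℝ}

theorem hasMean_cutSeq (hμ : 0 < μ) (hT : 0 < T) {b : ℕ × ℝ × ℝ × ℝ → ℝ} (hb : Measurable b) {m : ℝ}
    (h : HasMean (serviceLaw μ) (fun s => b (window T s)) m) :
    HasMean (serviceLaw μ) (fun s => b (window T (cutSeq T s))) m := by
  have hid : IdentDistrib (fun s => b (window T (cutSeq T s))) (fun s => b (window T s))
      (serviceLaw μ) (serviceLaw μ) := by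
    have hm : Measurable (fun s => b (window T s)) := hb.comp (measurable_window T)
    have hmp := measurePreserving_cutSeq hμ hT
    refine ⟨(hm.comp hmp.measurable).aemeasurable, hm.aemeasurable, ?_⟩
    conv_rhs => rw [← hmp.map_eq]
    rw [Measure.map_map hm hmp.measurable]
    rfl
  exact ⟨hid.integrable_iff.2 h.1, hid.integral_eq.trans h.2⟩

theorem hasMean_mul_cutSeq (hμ : 0 < μ) (hT : 0 < T) {a b : ℕ × ℝ × ℝ × ℝ → ℝ} (ha : Measurable a)
    (hb : Measurable b) {m m' : ℝ} (h : HasMean (serviceLaw μ) (fun s => a (window T s)) m)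
    (h' : HasMean (serviceLaw μ) (fun s => b (window T s)) m') :
    HasMean (serviceLaw μ) (fun s => a (window T s) * b (window T (cutSeq T s))) (m * m') := by
  have := isProbabilityMeasure_serviceLaw hμ
  have hc := hasMean_cutSeq hμ hT hb h'
  have hind := (iIndepFun_iterate (measurable_cutSeq T) (measurable_window T)
    (measure_window_inter_cutSeq hμ hT)).indepFun (zero_ne_one (α := ℕ))
  have hind' : IndepFun (fun s => a (window T s)) (fun s => b (window T (cutSeq T s)))
      (serviceLaw μ) := hind.comp ha hb
  refine ⟨hind'.integrable_mul h.1 hc.1, ?_⟩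
  rw [hind'.integral_fun_mul_eq_mul_integral h.1.aestronglyMeasurable hc.1.aestronglyMeasurable,
    h.2, hc.2]

theorem hasMean_countIs (hμ : 0 < μ) (hT : 0 < T) (k : ℕ) :
    HasMean (serviceLaw μ) (fun s => countIs k (window T s))
      ((μ * T) ^ k / k.factorial * Real.exp (-(μ * T))) :=
  integral_recvCount_eq hμ hT k

theorem hasMean_one_sub_countIs_zero (hμ : 0 < μ) (hT : 0 < T) :
    HasMean (serviceLaw μ) (fun s => 1 - countIs 0 (window T s)) (1 - Real.exp (-(μ * T))) := by
  have := isProbabilityMeasure_serviceLaw hμ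
  simpa using (HasMean.const (ν := serviceLaw μ) 1).sub (hasMean_countIs hμ hT 0)

theorem hasMean_periodCount (hμ : 0 < μ) (hT : 0 < T) :
    HasMean (serviceLaw μ) (fun s => periodCount (window T s, window T (cutSeq T s)))
      (μ * T + μ * T * Real.exp (-(μ * T)) + Real.exp (-(μ * T)) ^ 2) := by
  have hn : Measurable fun x : ℕ × ℝ × ℝ × ℝ => (x.1 : ℝ) :=
    (measurable_of_countable fun n : ℕ => (n : ℝ)).comp measurable_fst
  have h0 := hasMean_one_sub_countIs_zero hμ hT
  have hh := hasMean_mul_cutSeq hμ hT (a := fun x => 1 - countIs 0 x)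
    (b := fun x => 1 - countIs 0 x) (by fun_prop) (by fun_prop) h0 h0
  have hN := hasMean_cutSeq hμ hT (b := fun x => (x.1 : ℝ)) hn (integral_recvCount_cast hμ hT)
  have h0' := hasMean_cutSeq hμ hT (b := fun x => 1 - countIs 0 x) (by fun_prop) h0
  have c1 := hasMean_cutSeq hμ hT (measurable_countIs 1) (hasMean_countIs hμ hT 1)
  have c0 := hasMean_cutSeq hμ hT (measurable_countIs 0) (hasMean_countIs hμ hT 0)
  have key := (((hh.add hN).sub h0').add c1).add c0
  convert! key using 1
  simp
  ring

theorem hasMean_periodSum (hμ : 0 < μ) (hT : 0 < T) :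
    HasMean (serviceLaw μ) (fun s => periodSum T (window T s, window T (cutSeq T s)))
      ((2 * (μ * T) + (μ * T) ^ 2 * Real.exp (-(μ * T)) - 2 * Real.exp (-(μ * T))
        + 2 * Real.exp (-(μ * T)) ^ 2 + 2 * (μ * T) * Real.exp (-(μ * T)) ^ 2) / μ) := by
  have h0 := hasMean_one_sub_countIs_zero hμ hT
  have hF : HasMean _ _ _ := integral_windowFirst hμ hT
  have hL : HasMean _ _ _ := integral_windowLast hμ hT
  -- The mean stays unevaluated; it cancels between `hK` and `hK'`.
  have hK : HasMean (serviceLaw μ) (fun s => (window T s).2.2.2) _ :=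
    ⟨integrable_windowPrev hμ hT, rfl⟩
  have hh := hasMean_mul_cutSeq hμ hT (a := fun x => 1 - countIs 0 x)
    (b := fun x => 1 - countIs 0 x) (by fun_prop) (by fun_prop) h0 h0
  have hhF := hasMean_mul_cutSeq hμ hT (a := fun x => 1 - countIs 0 x)
    (b := fun x => x.2.1) (by fun_prop) (by fun_prop) h0 hF
  have hLh := hasMean_mul_cutSeq hμ hT (a := fun x => x.2.2.1)
    (b := fun x => 1 - countIs 0 x) (by fun_prop) (by fun_prop) hL h0
  have h0' := hasMean_cutSeq hμ hT (b := fun x => 1 - countIs 0 x) (by fun_prop) h0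
  have hF' := hasMean_cutSeq hμ hT (b := fun x => x.2.1) (by fun_prop) hF
  have hL' := hasMean_cutSeq hμ hT (b := fun x => x.2.2.1) (by fun_prop) hL
  have hK' := hasMean_cutSeq hμ hT (b := fun x => x.2.2.2) (by fun_prop) hK
  have c1 := hasMean_cutSeq hμ hT (measurable_countIs 1) (hasMean_countIs hμ hT 1)
  have c0 := hasMean_cutSeq hμ hT (measurable_countIs 0) (hasMean_countIs hμ hT 0)
  have key := (((((((((hh.const_mul T).add hhF).sub hK).add (h0'.const_mul T)).sub hLh).sub
    hF').add hL').add hK').add (c1.const_mul T)).add (c0.const_mul (2 * T))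
  convert! key using 1
  simp
  field_simp
  ring

end Means

/-! ### Reception times across successive periods -/

theorem genTime_residualSeq (k n : ℕ) (T : ℝ) (s : ℕ → ℝ) :
    genTime (residualSeq k T s) (n + 1) = genTime s (k + n + 1) - T := by
  unfold residualSeq
  rw [genTime_consSeq]
  induction n with
  | zero => simp
  | succ n ih =>
    rw [genTime_succ (fun i => s (k + 1 + i)), show k + (n + 1) + 1 = (k + n + 1) + 1 by ring, genTime_succ s (k + n + 1),
      show k + 1 + n = k + n + 1 by ring]
    linarith

/-- The index of the last reception up to time `j * T`. -/
def recvIndex (T : ℝ) (s : ℕ → ℝ) (j : ℕ) : ℕ :=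
  ∑ l ∈ Finset.range j, recvCount T ((cutSeq T)^[l] s)

theorem recvIndex_succ (T : ℝ) (s : ℕ → ℝ) (j : ℕ) :
    recvIndex T s (j + 1) = recvIndex T s j + recvCount T ((cutSeq T)^[j] s) :=
  Finset.sum_range_succ _ _

/-- Only positive indices are covered: at index `0` the left side is `0` by convention, whereas the
last reception up to `j * T` generally lies strictly earlier. -/
theorem genTime_iterate_cutSeq (T : ℝ) (s : ℕ → ℝ) (j : ℕ) : ∀ n,
    genTime ((cutSeq T)^[j] s) (n + 1) = genTime s (recvIndex T s j + n + 1) - j * T := by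
  induction j with
  | zero => intro n; simp [recvIndex]
  | succ j ih =>
    intro n
    rw [Function.iterate_succ_apply', cutSeq, genTime_residualSeq, ih, recvIndex_succ]
    push_cast
    rw [show recvIndex T s j + (recvCount T ((cutSeq T)^[j] s) + n) + 1
      = recvIndex T s j + recvCount T ((cutSeq T)^[j] s) + n + 1 by ring]
    ring

/-- What is seen from each multiple of `T` on has positive service times and a reception after any
further delay `T`. -/
def IsRegularService (T : ℝ) (s : ℕ → ℝ) : Prop :=
  ∀ j, (∀ i, 0 < (cutSeq T)^[j] s i) ∧ ∃ n, T ≤ genTime ((cutSeq T)^[j] s) (n + 1)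

namespace IsRegularService

variable {T : ℝ} {s : ℕ → ℝ}

theorem pos (h : IsRegularService T s) (i : ℕ) : 0 < s i := (h 0).1 i

/-- The difference of the two sides is the first residual service time after `j * T`, which is
positive. -/
theorem lt_genTime (h : IsRegularService T s) (j : ℕ) : j * T < genTime s (recvIndex T s j + 1) := by
  have h1 := genTime_iterate_cutSeq T s j 0
  have h2 := (h j).1 0
  rw [zero_add, add_zero] at h1
  have h3 : genTime ((cutSeq T)^[j] s) 1 = (cutSeq T)^[j] s 0 := by simp [genTime]
  linarith

/-- The second bound for `j` yields the first for `j + 1`, so they are proved together. The first is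
not strict because both sides vanish at `j = 0`. -/
theorem genTime_le (hT : 0 < T) (j : ℕ) : genTime s (recvIndex T s j) ≤ j * T ∧
    genTime s (recvIndex T s (j + 1)) < (j + 1) * T := by
  induction j with
  | zero =>
    refine ⟨by simp [recvIndex], ?_⟩
    have := genTime_recvCount_lt hT (s := s)
    simpa [recvIndex] using this
  | succ j ih =>
    push_cast
    refine ⟨ih.2.le, ?_⟩
    rw [recvIndex_succ]
    have h1 := genTime_recvCount_lt hT (s := (cutSeq T)^[j + 1] s)
    rcases Nat.eq_zero_or_pos (recvCount T ((cutSeq T)^[j + 1] s)) with h0 | h0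
    · rw [h0, add_zero]
      linarith [ih.2]
    · obtain ⟨n, hn⟩ := Nat.exists_eq_succ_of_ne_zero h0.ne'
      rw [hn] at h1 ⊢
      rw [Nat.succ_eq_add_one, genTime_iterate_cutSeq] at h1
      push_cast at h1
      rw [show recvIndex T s (j + 1) + n.succ = recvIndex T s (j + 1) + n + 1 from rfl]
      linarith

end IsRegularService

theorem mem_updatesMD {s : ℕ → ℝ} {T g r : ℝ} : (g, r) ∈ updatesMD s T ↔
    (∃ k, g = genTime s k ∧ r = genTime s (k + 1)) ∨ ∃ k : ℕ, g = k * T ∧ r = (k + 1) * T := by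
  have hc : ∀ n : ℕ, genTime (fun _ => T) n = n * T := fun n => by simp [genTime]
  simp only [updatesMD, updates, Set.mem_union, Set.mem_range, Prod.mk.injEq, recvTime, hc,
    ← genTime_succ]
  refine or_congr (exists_congr fun k => ?_) (exists_congr fun k => ?_)
  · exact and_congr eq_comm eq_comm
  · refine and_congr eq_comm ⟨fun h => ?_, fun h => ?_⟩ <;> linarith

/-! ### The peaks inside one period of B -/

section Period

variable {T Δ₀ : ℝ} {s : ℕ → ℝ} (hT : 0 < T) (hΔ₀ : 0 ≤ Δ₀) (hs : ∀ i, 0 < s i)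

include hT hΔ₀ hs

/-- Among the updates received before `t`, the freshest of B was generated at `iT` and the freshest
of A at `genTime s (N - 1)`. If `N = 0`, truncated subtraction gives `0`, which is harmless since
`iT ≥ 0`; the same bound makes the initial age irrelevant. -/
theorem ageBefore_eq {i N : ℕ} {t : ℝ} (h1 : (i + 1) * T < t) (h2 : t ≤ (i + 2) * T)
    (hN : genTime s N < t) (hN' : t ≤ genTime s (N + 1)) :
    ageBefore Δ₀ (updatesMD s T) t = t - max (i * T) (genTime s (N - 1)) := by
  have hm := genTime_strictMono hs
  have hi : (0 : ℝ) ≤ i * T := by positivity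
  unfold ageBefore
  congr 1
  refine IsGreatest.csSup_eq ⟨?_, ?_⟩
  · rcases max_choice (i * T) (genTime s (N - 1)) with h | h
    · rw [h]
      exact Or.inr ⟨(i + 1) * T, mem_updatesMD.2 (Or.inr ⟨i, rfl, rfl⟩), h1⟩
    · rcases Nat.eq_zero_or_pos N with h0 | h0
      · subst h0
        have h' : max (i * T) (genTime s (0 - 1)) = i * T := max_eq_left (by simpa using hi)
        rw [h']
        exact Or.inr ⟨(i + 1) * T, mem_updatesMD.2 (Or.inr ⟨i, rfl, rfl⟩), h1⟩
      · rw [h]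
        refine Or.inr ⟨genTime s N, mem_updatesMD.2 (Or.inl ⟨N - 1, rfl, ?_⟩), hN⟩
        rw [Nat.sub_add_cancel h0]
  · rintro g (rfl | ⟨r, hr, hrt⟩)
    · exact le_max_of_le_left (by linarith)
    · rcases mem_updatesMD.1 hr with ⟨k, rfl, rfl⟩ | ⟨k, rfl, rfl⟩
      · refine le_max_of_le_right (hm.monotone ?_)
        have := hm.lt_iff_lt.1 (hrt.trans_le hN')
        omega
      · refine le_max_of_le_left ?_
        have h3 : ((k : ℝ) + 1) < i + 2 := lt_of_mul_lt_mul_right (hrt.trans_le h2) hT.le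
        have h4 : k ≤ i := by
          have : ((k + 1 : ℕ) : ℝ) < ((i + 2 : ℕ) : ℝ) := by push_cast; exact h3
          have := Nat.cast_lt.1 this
          omega
        have h5 : (k : ℝ) ≤ i := by exact_mod_cast h4
        exact mul_le_mul_of_nonneg_right h5 hT.le

variable {i m m' m'' : ℕ} (hmm : m ≤ m') (hmm' : m' ≤ m'') (a1 : genTime s m ≤ i * T)
  (a2 : i * T < genTime s (m + 1)) (a3 : genTime s m' < (i + 1) * T)
  (a4 : (i + 1) * T < genTime s (m' + 1)) (a5 : genTime s m'' < (i + 2) * T)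
  (a6 : (i + 2) * T < genTime s (m'' + 1))

include hmm hmm' a1 a2 a3 a4 a5 a6

/-- Here `m`, `m'`, `m''` index the last A-receptions up to `iT`, `(i+1)T`, `(i+2)T`. Update `k` of
A is received in the period iff `m' ≤ k < m''`, and is then fresher than the B-information from `iT`
iff `m + 1 ≤ k`. The update of B generated at `(i+1)T` is fresher than update `m'' - 1` of A iff
`m'' - 1 ≤ m'`. -/
theorem peakTimes_inter_Ioc :
    peakTimes Δ₀ (updatesMD s T) ∩ Set.Ioc ((i + 1) * T) ((i + 2) * T)
      = ((Finset.Ico (max m' (m + 1)) m'').image (fun k => genTime s (k + 1)) ∪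
        (if m'' ≤ m' + 1 then {((i : ℝ) + 2) * T} else ∅) : Finset ℝ) := by
  have hm := genTime_strictMono hs
  have hB : ((i : ℝ) + 1) * T < (i + 2) * T := mul_lt_mul_of_pos_right (by linarith) hT
  have hAge := @ageBefore_eq _ _ _ hT hΔ₀ hs i
  ext t
  simp only [Set.mem_inter_iff, Set.mem_Ioc, Finset.coe_union, Finset.coe_image, Set.mem_union,
    Set.mem_image, Finset.mem_coe, Finset.mem_Ico]
  constructor
  · rintro ⟨⟨g, hg, hlt⟩, ht1, ht2⟩
    rcases mem_updatesMD.1 hg with ⟨k, rfl, rfl⟩ | ⟨k, rfl, rfl⟩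
    · left
      refine ⟨k, ⟨?_, ?_⟩, rfl⟩
      · rw [hAge ht1 ht2 (hm (Nat.lt_succ_self k)) le_rfl] at hlt
        have h1 : i * T < genTime s k :=
          lt_of_le_of_lt (le_max_left _ (genTime s (k - 1))) (by linarith)
        have h2 := hm.lt_iff_lt.1 (a1.trans_lt h1)
        have h3 := hm.lt_iff_lt.1 (a3.trans ht1)
        omega
      · have := hm.lt_iff_lt.1 (ht2.trans_lt a6)
        omega
    · right
      have h1 : ((i + 1 : ℕ) : ℝ) < ((k + 1 : ℕ) : ℝ) := by
        push_cast
        exact lt_of_mul_lt_mul_right ht1 hT.le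
      have h2 : ((k + 1 : ℕ) : ℝ) ≤ ((i + 2 : ℕ) : ℝ) := by
        push_cast
        exact le_of_mul_le_mul_right ht2 hT
      have h3 : k = i + 1 := by
        have := Nat.cast_lt.1 h1
        have := Nat.cast_le.1 h2
        omega
      subst h3
      have e : (((i + 1 : ℕ) : ℝ) + 1) * T = (i + 2) * T := by push_cast; ring
      rw [e] at hlt ⊢
      rw [hAge hB le_rfl a5 a6.le] at hlt
      push_cast at hlt
      have h4 : genTime s (m'' - 1) < (i + 1) * T :=
        lt_of_le_of_lt (le_max_right (i * T) _) (by linarith)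
      have h5 := hm.lt_iff_lt.1 (h4.trans a4)
      rw [if_pos (by omega)]
      simp
  · rintro (⟨k, ⟨hk1, hk2⟩, rfl⟩ | ht)
    · have hk3 : m' ≤ k := (le_max_left _ _).trans hk1
      have hk4 : m + 1 ≤ k := (le_max_right _ _).trans hk1
      have ht1 : (i + 1) * T < genTime s (k + 1) := a4.trans_le (hm.monotone (by omega))
      have ht2 : genTime s (k + 1) ≤ (i + 2) * T := (hm.monotone (by omega)).trans a5.le
      refine ⟨⟨genTime s k, mem_updatesMD.2 (Or.inl ⟨k, rfl, rfl⟩), ?_⟩, ht1, ht2⟩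
      rw [hAge ht1 ht2 (hm (Nat.lt_succ_self k)) le_rfl]
      refine sub_lt_sub_left (max_lt (a2.trans_le (hm.monotone hk4)) (hm ?_)) _
      omega
    · split_ifs at ht with hle
      · obtain rfl := Finset.mem_singleton.1 ht
        refine ⟨⟨(i + 1) * T, mem_updatesMD.2 (Or.inr ⟨i + 1, ?_, ?_⟩), ?_⟩, hB, le_rfl⟩
        · push_cast; ring
        · push_cast; ring
        · rw [hAge hB le_rfl a5 a6.le]
          refine sub_lt_sub_left (max_lt (by nlinarith) (lt_of_le_of_lt (hm.monotone ?_) a3)) _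
          omega
      · exact absurd ht (Finset.notMem_empty _)

theorem peakCount_period :
    peakCount Δ₀ (updatesMD s T) (Set.Ioc ((i + 1) * T) ((i + 2) * T))
      = ((m'' - max m' (m + 1) : ℕ) : ℝ) + (if m'' ≤ m' + 1 then 1 else 0) := by
  have hm := genTime_strictMono hs
  unfold peakCount
  rw [peakTimes_inter_Ioc hT hΔ₀ hs hmm hmm' a1 a2 a3 a4 a5 a6, Set.ncard_coe_finset,
    Finset.card_union_of_disjoint, Finset.card_image_of_injective, Nat.card_Ico]
  · push_cast
    congr 1
    split_ifs <;> simp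
  · intro k l hkl
    have := hm.injective hkl
    omega
  · rw [Finset.disjoint_left]
    intro t ht ht'
    obtain ⟨k, hk, rfl⟩ := Finset.mem_image.1 ht
    have h1 : genTime s (k + 1) < (i + 2) * T :=
      (hm.monotone (by have := (Finset.mem_Ico.1 hk).2; omega)).trans_lt a5
    split_ifs at ht'
    · exact h1.ne (Finset.mem_singleton.1 ht')
    · simp at ht'

/-- The reception time is also written as a maximum with `iT`, which does not change it, so that all
terms are differences of one sequence and telescope. -/
theorem peakSum_period :
    peakSum Δ₀ (updatesMD s T) (Set.Ioc ((i + 1) * T) ((i + 2) * T))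
      = ∑ k ∈ Finset.Ico (max m' (m + 1)) m'',
          (max (i * T) (genTime s (k + 1)) - max (i * T) (genTime s (k - 1)))
        + (if m'' ≤ m' + 1 then (i + 2) * T - max (i * T) (genTime s (m'' - 1)) else 0) := by
  have hm := genTime_strictMono hs
  have hB : ((i : ℝ) + 1) * T < (i + 2) * T := mul_lt_mul_of_pos_right (by linarith) hT
  have hAge := @ageBefore_eq _ _ _ hT hΔ₀ hs i
  unfold peakSum
  rw [peakTimes_inter_Ioc hT hΔ₀ hs hmm hmm' a1 a2 a3 a4 a5 a6, finsum_mem_coe_finset,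
    Finset.sum_union, Finset.sum_image]
  · congr 1
    · refine Finset.sum_congr rfl fun k hk => ?_
      obtain ⟨hk1, hk2⟩ := Finset.mem_Ico.1 hk
      have hk3 : m' ≤ k := (le_max_left _ _).trans hk1
      have hk4 : m + 1 ≤ k := (le_max_right _ _).trans hk1
      have ht1 : (i + 1) * T < genTime s (k + 1) := a4.trans_le (hm.monotone (by omega))
      have ht2 : genTime s (k + 1) ≤ (i + 2) * T := (hm.monotone (by omega)).trans a5.le
      rw [hAge ht1 ht2 (hm (Nat.lt_succ_self k)) le_rfl, max_eq_right (b := genTime s (k + 1))]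
      exact (a2.trans_le (hm.monotone (by omega))).le
    · split_ifs
      · rw [Finset.sum_singleton, hAge hB le_rfl a5 a6.le]
      · simp
  · intro k _ l _ hkl
    have := hm.injective hkl
    omega
  · rw [Finset.disjoint_left]
    intro t ht ht'
    obtain ⟨k, hk, rfl⟩ := Finset.mem_image.1 ht
    have h1 : genTime s (k + 1) < (i + 2) * T :=
      (hm.monotone (by have := (Finset.mem_Ico.1 hk).2; omega)).trans_lt a5
    split_ifs at ht'
    · exact h1.ne (Finset.mem_singleton.1 ht')
    · simp at ht'

end Period

/-- Telescoping with step two leaves two boundary terms at each end. Starting at `p + 1` keeps `k -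
1` free of truncation. -/
theorem sum_Ico_sub_two_back (v : ℕ → ℝ) (p d : ℕ) :
    ∑ k ∈ Finset.Ico (p + 1) (p + 1 + d), (v (k + 1) - v (k - 1))
      = v (p + 1 + d) + v (p + d) - v (p + 1) - v p := by
  induction d with
  | zero => simp
  | succ d ih =>
    rw [← add_assoc, Finset.sum_Ico_succ_top (by omega), ih,
      show p + 1 + d - 1 = p + d by omega, show p + (d + 1) = p + 1 + d by ring]
    ring

namespace IsRegularService

variable {T Δ₀ : ℝ} {s : ℕ → ℝ}

theorem peakCount_eq (h : IsRegularService T s) (hT : 0 < T) (hΔ₀ : 0 ≤ Δ₀) (i : ℕ) :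
    peakCount Δ₀ (updatesMD s T) (Set.Ioc ((i + 1) * T) ((i + 2) * T))
      = periodCount (window T ((cutSeq T)^[i] s), window T ((cutSeq T)^[i + 1] s)) := by
  have e1 := recvIndex_succ T s i
  have e2 : recvIndex T s (i + 2)
    = recvIndex T s (i + 1) + recvCount T ((cutSeq T)^[i + 1] s) := recvIndex_succ T s (i + 1)
  have a4 := h.lt_genTime (i + 1)
  have a6 := h.lt_genTime (i + 1 + 1)
  have a5 := (genTime_le (s := s) hT (i + 1)).2
  push_cast [add_assoc, one_add_one_eq_two] at a4 a6 a5
  rw [peakCount_period hT hΔ₀ h.pos (by omega) (by omega) (genTime_le hT i).1 (h.lt_genTime i)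
    (genTime_le hT i).2 a4 a5 a6]
  have w1 : (window T ((cutSeq T)^[i] s)).1 = recvCount T ((cutSeq T)^[i] s) := rfl
  have w2 : (window T ((cutSeq T)^[i + 1] s)).1 = recvCount T ((cutSeq T)^[i + 1] s) := rfl
  simp only [periodCount, countIs, w1, w2]
  rw [show recvIndex T s (i + 2) = recvIndex T s i + recvCount T ((cutSeq T)^[i] s) +
    recvCount T ((cutSeq T)^[i + 1] s) by rw [e2, e1], e1]
  generalize recvIndex T s i = m
  generalize recvCount T ((cutSeq T)^[i] s) = M'
  generalize recvCount T ((cutSeq T)^[i + 1] s) = M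
  -- If `M' = 0`, the first A-update received in the period was generated no later than `iT` and is
  -- obsolete; the maximum is then `m + 1`.
  rcases Nat.eq_zero_or_pos M' with h0 | h0
  · subst h0
    rcases M with _ | _ | M
    · simp
    · simp
    · rw [show m + 0 + (M + 1 + 1) - max (m + 0) (m + 1) = M + 1 by omega,
        if_neg (show ¬ m + 0 + (M + 1 + 1) ≤ m + 0 + 1 by omega)]
      push_cast
      simp
  · rw [max_eq_left (by omega), Nat.add_sub_cancel_left]
    rcases M with _ | _ | M
    · simp
    · simp [h0.ne']
    · rw [if_neg (show ¬ m + M' + (M + 1 + 1) ≤ m + M' + 1 by omega)]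
      push_cast
      simp [h0.ne']

theorem periodSum_mk (T : ℝ) (M' M : ℕ) (F' L' K' F L K : ℝ) :
    periodSum T ((M', F', L', K'), (M, F, L, K))
      = T * ((1 - if M' = 0 then 1 else 0) * (1 - if M = 0 then 1 else 0))
        + (1 - if M' = 0 then 1 else 0) * F - K' + T * (1 - if M = 0 then 1 else 0)
        - L' * (1 - if M = 0 then 1 else 0) - F + L + K + T * (if M = 1 then 1 else 0)
        + 2 * T * (if M = 0 then 1 else 0) := rfl

theorem peakSum_eq (h : IsRegularService T s) (hT : 0 < T) (hΔ₀ : 0 ≤ Δ₀) (i : ℕ) :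
    peakSum Δ₀ (updatesMD s T) (Set.Ioc ((i + 1) * T) ((i + 2) * T))
      = periodSum T (window T ((cutSeq T)^[i] s), window T ((cutSeq T)^[i + 1] s)) := by
  have e1 := recvIndex_succ T s i
  have e2 : recvIndex T s (i + 2)
    = recvIndex T s (i + 1) + recvCount T ((cutSeq T)^[i + 1] s) := recvIndex_succ T s (i + 1)
  have a1 := (genTime_le (s := s) hT i).1
  have a2 := h.lt_genTime i
  have a4 := h.lt_genTime (i + 1)
  have a6 := h.lt_genTime (i + 1 + 1)
  have a5 := (genTime_le (s := s) hT (i + 1)).2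
  have b := genTime_iterate_cutSeq T s i
  have b' := genTime_iterate_cutSeq T s (i + 1)
  push_cast [add_assoc, one_add_one_eq_two] at a4 a6 a5
  rw [peakSum_period hT hΔ₀ h.pos (by omega) (by omega) a1 a2 (genTime_le hT i).2 a4 a5 a6]
  have w1 : window T ((cutSeq T)^[i] s)
    = windowAt (recvCount T ((cutSeq T)^[i] s)) ((cutSeq T)^[i] s) := rfl
  have w2 : window T ((cutSeq T)^[i + 1] s)
    = windowAt (recvCount T ((cutSeq T)^[i + 1] s)) ((cutSeq T)^[i + 1] s) := rfl
  rw [w1, w2]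
  have hm := genTime_strictMono h.pos
  unfold windowAt
  rw [periodSum_mk]
  rw [show recvIndex T s (i + 2) = recvIndex T s i + recvCount T ((cutSeq T)^[i] s) +
    recvCount T ((cutSeq T)^[i + 1] s) by rw [e2, e1], e1]
  rw [e1] at b'
  generalize recvCount T ((cutSeq T)^[i] s) = M' at *
  generalize recvCount T ((cutSeq T)^[i + 1] s) = M at *
  generalize recvIndex T s i = m at *
  -- Truncation at `iT` matches the windows, which record `0` for a missing reception: `v (m + n)`
  -- is `iT` plus the window time, even for `n = 0`.
  set v : ℕ → ℝ := fun k => max (i * T) (genTime s k) with hv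
  have hvs : ∀ n, v (m + n) = i * T + genTime ((cutSeq T)^[i] s) n := by
    intro n
    rcases n with _ | n
    · simp only [hv, add_zero, genTime_zero]
      exact max_eq_left a1
    · rw [b]
      simp only [hv]
      rw [max_eq_right, ← add_assoc]
      · ring
      · exact (a2.trans_le (hm.monotone (by omega))).le
  have hvp : v (m + M' - 1) = i * T + genTime ((cutSeq T)^[i] s) (M' - 1) := by
    rcases Nat.eq_zero_or_pos M' with h0 | h0
    · subst h0
      rw [Nat.zero_sub, genTime_zero, add_zero, add_zero]
      exact max_eq_left ((hm.monotone (Nat.sub_le _ _)).trans a1)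
    · rw [Nat.add_sub_assoc h0, hvs]
  have hvn : ∀ n, v (m + M' + (n + 1))
      = (i + 1) * T + genTime ((cutSeq T)^[i + 1] s) (n + 1) := by
    intro n
    rw [b']
    simp only [hv]
    rw [max_eq_right, ← add_assoc]
    · push_cast; ring
    · exact (a2.trans_le (hm.monotone (by omega))).le
  change ∑ k ∈ Finset.Ico (max (m + M') (m + 1)) (m + M' + M), (v (k + 1) - v (k - 1))
    + (if m + M' + M ≤ m + M' + 1 then (i + 2) * T - v (m + M' + M - 1) else 0) = _
  -- The telescoping sum starts at `k = m + M' + 1`. The extra term `k = m + M'` is present exactly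
  -- when `M' > 0`, i.e. when that update was generated after `iT`.
  have hsum : 0 < M → ∑ k ∈ Finset.Ico (max (m + M') (m + 1)) (m + M' + M), (v (k + 1) - v (k - 1))
      = (if M' = 0 then 0 else v (m + M' + 1) - v (m + M' - 1)) +
        (v (m + M' + M) + v (m + M' + M - 1) - v (m + M' + 1) - v (m + M')) := by
    intro hM
    obtain ⟨d, rfl⟩ := Nat.exists_eq_succ_of_ne_zero hM.ne'
    have key := sum_Ico_sub_two_back v (m + M') d
    rw [show m + M' + d.succ - 1 = m + M' + d by omega,
      show m + M' + d.succ = m + M' + 1 + d by omega, ← key]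
    split_ifs with h0
    · subst h0
      rw [zero_add, max_eq_right (by omega)]
    · rw [max_eq_left (by omega), Finset.sum_eq_sum_Ico_succ_bot (by omega)]
  -- The peak of B occurs only for `M = 0` and `M = 1`; from `M = 2` on, the last but one reception
  -- lies in the current window.
  rcases M with _ | _ | M
  · rw [Finset.Ico_eq_empty (by omega), if_pos (show m + M' + 0 ≤ m + M' + 1 by omega), add_zero, hvp]
    simp
    ring
  · rw [hsum (by omega), if_pos (show m + M' + (0 + 1) ≤ m + M' + 1 by omega)]
    simp only [zero_add, Nat.add_sub_cancel]
    rw [hvp, hvs, hvn 0]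
    by_cases h0 : M' = 0
    · subst h0
      simp
      ring
    · simp [h0]
      ring
  · rw [hsum (by omega), if_neg (show ¬ m + M' + (M + 1 + 1) ≤ m + M' + 1 by omega)]
    rw [show m + M' + (M + 1 + 1) - 1 = m + M' + (M + 1) by omega,
      show M + 1 + 1 - 1 = M + 1 by omega, min_eq_left (by omega), hvp, hvs,
      hvn (M + 1), hvn M, show m + M' + 1 = m + M' + (0 + 1) by omega, hvn 0]
    by_cases h0 : M' = 0
    · subst h0
      simp
      ring
    · simp [h0]
      ring

end IsRegularService

/-! ### From averages over periods to averages over time -/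

/-- A monotone function whose increments over consecutive periods average to `m` grows by `m` per
period. -/
theorem tendsto_div_floor_of_average {f : ℝ → ℝ} (hf : Monotone f) {T : ℝ} (hT : 0 < T)
    {g : ℕ → ℝ} (hg : ∀ i : ℕ, f ((i + 2) * T) = f ((i + 1) * T) + g i) {m : ℝ}
    (h : Tendsto (fun n : ℕ => (∑ i ∈ Finset.range n, g i) / n) atTop (𝓝 m)) :
    Tendsto (fun τ : ℝ => f τ / (⌊τ / T⌋₊ : ℝ)) atTop (𝓝 m) := by
  -- The first period follows no two-window formula; it enters only through the constant `f T`,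
  -- negligible after division by `n`.
  have hsum : ∀ n : ℕ, f ((n + 1) * T) = f T + ∑ i ∈ Finset.range n, g i := by
    intro n
    induction n with
    | zero => simp
    | succ n ih =>
      rw [Finset.sum_range_succ, ← add_assoc, ← ih, ← hg]
      congr 1
      push_cast
      ring
  have hc : Tendsto (fun n : ℕ => f T / n) atTop (𝓝 0) := tendsto_const_div_atTop_nhds_zero_nat _
  have hup : Tendsto (fun n : ℕ => f ((n + 1) * T) / n) atTop (𝓝 m) := by
    have := hc.add h
    rw [zero_add] at this
    refine this.congr fun n => ?_
    rw [hsum, add_div]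
  have hlo : Tendsto (fun n : ℕ => f (n * T) / n) atTop (𝓝 m) := by
    rw [← tendsto_add_atTop_iff_nat 1]
    have hr : Tendsto (fun n : ℕ => (n : ℝ) / (n + 1)) atTop (𝓝 1) :=
      tendsto_natCast_div_add_atTop 1
    have := hup.mul hr
    rw [mul_one] at this
    refine this.congr' ?_
    filter_upwards [eventually_gt_atTop 0] with n hn
    have hn' : (n : ℝ) ≠ 0 := by exact_mod_cast hn.ne'
    push_cast
    field_simp
  have hfl : Tendsto (fun τ : ℝ => ⌊τ / T⌋₊) atTop atTop :=
    tendsto_nat_floor_atTop.comp (tendsto_id.atTop_div_const hT)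
  -- With `n = ⌊τ / T⌋₊`, monotonicity squeezes `f τ` between `f (n * T)` and `f ((n + 1) * T)`.
  refine tendsto_of_tendsto_of_tendsto_of_le_of_le' (hlo.comp hfl) (hup.comp hfl) ?_ ?_
  · filter_upwards [eventually_ge_atTop 0] with τ hτ
    refine div_le_div_of_nonneg_right (hf ?_) (Nat.cast_nonneg _)
    exact (le_div_iff₀ hT).1 (Nat.floor_le (by positivity))
  · filter_upwards with τ
    refine div_le_div_of_nonneg_right (hf ?_) (Nat.cast_nonneg _)
    exact ((div_lt_iff₀ hT).1 (Nat.lt_floor_add_one _)).le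

/-- A peak strictly exceeds the age of the update being received, which is nonnegative. This makes
the cumulative peak sum monotone. -/
theorem ageBefore_pos_of_mem_peakTimes {T Δ₀ : ℝ} {s : ℕ → ℝ} (hT : 0 < T) (hs : ∀ i, 0 < s i)
    {t : ℝ} (ht : t ∈ peakTimes Δ₀ (updatesMD s T)) : 0 < ageBefore Δ₀ (updatesMD s T) t := by
  obtain ⟨g, hg, hlt⟩ := ht
  refine lt_of_le_of_lt (sub_nonneg.2 ?_) hlt
  rcases mem_updatesMD.1 hg with ⟨k, rfl, rfl⟩ | ⟨k, rfl, rfl⟩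
  · exact (genTime_strictMono hs).monotone (Nat.le_succ k)
  · nlinarith

theorem inter_Ioc_union {P : Set ℝ} {a b c : ℝ} (hab : a ≤ b) (hbc : b ≤ c) :
    P ∩ Set.Ioc a c = P ∩ Set.Ioc a b ∪ P ∩ Set.Ioc b c := by
  rw [← Set.inter_union_distrib_left, Set.Ioc_union_Ioc_eq_Ioc hab hbc]

theorem disjoint_inter_Ioc (P : Set ℝ) (a b c : ℝ) :
    Disjoint (P ∩ Set.Ioc a b) (P ∩ Set.Ioc b c) := by
  rw [Set.disjoint_left]
  rintro t ⟨-, -, h1⟩ ⟨-, h2, -⟩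
  exact absurd h2 (not_lt.2 h1)

theorem monotone_of_add {V : Set ℝ → ℝ} (h0 : ∀ I, 0 ≤ V I)
    (hadd : ∀ a b c : ℝ, a ≤ b → b ≤ c →
      V (Set.Ioc a c) = V (Set.Ioc a b) + V (Set.Ioc b c)) (he : V ∅ = 0) :
    Monotone fun τ : ℝ => V (Set.Ioc 0 τ) := by
  intro a b hab
  rcases le_total 0 a with ha | ha
  · change V (Set.Ioc 0 a) ≤ V (Set.Ioc 0 b)
    rw [hadd 0 a b ha hab]
    linarith [h0 (Set.Ioc a b)]
  · change V (Set.Ioc 0 a) ≤ V (Set.Ioc 0 b)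
    rw [Set.Ioc_eq_empty (not_lt.2 ha), he]
    exact h0 _

namespace IsRegularService

variable {T Δ₀ : ℝ} {s : ℕ → ℝ}

theorem finite_peakTimes (h : IsRegularService T s) (hT : 0 < T) (a τ : ℝ) :
    (peakTimes Δ₀ (updatesMD s T) ∩ Set.Ioc a τ).Finite := by
  obtain ⟨j, hj⟩ := exists_nat_ge (τ / T)
  rw [div_le_iff₀ hT] at hj
  refine (((Set.finite_Iio (recvIndex T s j + 1)).image (genTime s)).union
    ((Set.finite_Iio (j + 1)).image (fun k : ℕ => (k : ℝ) * T))).subset ?_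
  rintro t ⟨⟨g, hg, -⟩, -, ht⟩
  rcases mem_updatesMD.1 hg with ⟨k, rfl, rfl⟩ | ⟨k, rfl, rfl⟩
  · refine Or.inl ⟨k + 1, ?_, rfl⟩
    exact (genTime_strictMono h.pos).lt_iff_lt.1 ((ht.trans hj).trans_lt (h.lt_genTime j))
  · refine Or.inr ⟨k + 1, ?_, by push_cast; rfl⟩
    have h1 : ((k + 1 : ℕ) : ℝ) ≤ j := by
      push_cast
      exact le_of_mul_le_mul_right (ht.trans hj) hT
    have h2 : k + 1 ≤ j := by exact_mod_cast h1
    exact Set.mem_Iio.2 (by omega)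

theorem peakCount_add (h : IsRegularService T s) (hT : 0 < T) {a b c : ℝ} (hab : a ≤ b)
    (hbc : b ≤ c) : peakCount Δ₀ (updatesMD s T) (Set.Ioc a c)
      = peakCount Δ₀ (updatesMD s T) (Set.Ioc a b)
        + peakCount Δ₀ (updatesMD s T) (Set.Ioc b c) := by
  unfold peakCount
  rw [inter_Ioc_union hab hbc, Set.ncard_union_eq (disjoint_inter_Ioc _ _ _ _)
    (h.finite_peakTimes hT _ _) (h.finite_peakTimes hT _ _)]
  push_cast
  rfl

theorem peakSum_add (h : IsRegularService T s) (hT : 0 < T) {a b c : ℝ} (hab : a ≤ b)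
    (hbc : b ≤ c) : peakSum Δ₀ (updatesMD s T) (Set.Ioc a c)
      = peakSum Δ₀ (updatesMD s T) (Set.Ioc a b) + peakSum Δ₀ (updatesMD s T) (Set.Ioc b c) := by
  unfold peakSum
  rw [inter_Ioc_union hab hbc, finsum_mem_union (disjoint_inter_Ioc _ _ _ _)
    (h.finite_peakTimes hT _ _) (h.finite_peakTimes hT _ _)]

theorem monotone_peakCount (h : IsRegularService T s) (hT : 0 < T) :
    Monotone fun τ : ℝ => peakCount Δ₀ (updatesMD s T) (Set.Ioc 0 τ) :=
  monotone_of_add (fun _ => Nat.cast_nonneg _) (fun _ _ _ => h.peakCount_add hT)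
    (by simp [peakCount])

theorem monotone_peakSum (h : IsRegularService T s) (hT : 0 < T) :
    Monotone fun τ : ℝ => peakSum Δ₀ (updatesMD s T) (Set.Ioc 0 τ) :=
  monotone_of_add
    (fun _ => finsum_nonneg fun _ => finsum_nonneg fun ht =>
      (ageBefore_pos_of_mem_peakTimes hT h.pos ht.1).le)
    (fun _ _ _ => h.peakSum_add hT) (by simp [peakSum])

/-- The long-run average of the peaks, from the averages over the service periods. -/
theorem tendsto_average_peak (h : IsRegularService T s) (hT : 0 < T) (hΔ₀ : 0 ≤ Δ₀) {mS mC : ℝ}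
    (hS : Tendsto (fun n : ℕ => (∑ i ∈ Finset.range n,
      periodSum T (window T ((cutSeq T)^[i] s), window T ((cutSeq T)^[i + 1] s))) / n)
      atTop (𝓝 mS))
    (hC : Tendsto (fun n : ℕ => (∑ i ∈ Finset.range n,
      periodCount (window T ((cutSeq T)^[i] s), window T ((cutSeq T)^[i + 1] s))) / n)
      atTop (𝓝 mC)) (hmC : mC ≠ 0) :
    Tendsto (fun τ : ℝ => peakSum Δ₀ (updatesMD s T) (Set.Ioc 0 τ) /
      peakCount Δ₀ (updatesMD s T) (Set.Ioc 0 τ)) atTop (𝓝 (mS / mC)) := by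
  have hle : ∀ i : ℕ, (0 : ℝ) ≤ (i + 1) * T ∧ ((i : ℝ) + 1) * T ≤ (i + 2) * T := fun i =>
    ⟨by positivity, mul_le_mul_of_nonneg_right (by linarith) hT.le⟩
  have kS := tendsto_div_floor_of_average (h.monotone_peakSum (Δ₀ := Δ₀) hT) hT
    (fun i => (h.peakSum_add hT (hle i).1 (hle i).2).trans
      (congrArg _ (h.peakSum_eq hT hΔ₀ i))) hS
  have kC := tendsto_div_floor_of_average (h.monotone_peakCount (Δ₀ := Δ₀) hT) hT
    (fun i => (h.peakCount_add hT (hle i).1 (hle i).2).trans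
      (congrArg _ (h.peakCount_eq hT hΔ₀ i))) hC
  refine (kS.div kC hmC).congr' ?_
  filter_upwards [eventually_ge_atTop T] with τ hτ
  have : (⌊τ / T⌋₊ : ℝ) ≠ 0 := by
    have h1 : 1 ≤ ⌊τ / T⌋₊ := Nat.le_floor (by rw [Nat.cast_one, le_div_iff₀ hT, one_mul]; exact hτ)
    exact_mod_cast (Nat.pos_of_ne_zero (by omega)).ne'
  exact div_div_div_cancel_right₀ this _ _

end IsRegularService

/-! ### Transfer to the probability space and conclusion -/

/-- Almost sure equality with a measurable function of two windows suffices, so measurability of the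
peak functionals never has to be shown directly. -/
theorem HasMean.comp_iterate_pair {μ T : ℝ} (hμ : 0 < μ) (hT : 0 < T)
    {g : (ℕ × ℝ × ℝ × ℝ) × (ℕ × ℝ × ℝ × ℝ) → ℝ} (hg : Measurable g) {m : ℝ}
    (h : HasMean (serviceLaw μ) (fun s => g (window T s, window T (cutSeq T s))) m) (i : ℕ)
    {Ω : Type*} [MeasurableSpace Ω] {P : Measure Ω} {S : Ω → ℕ → ℝ}
    (hS : MeasurePreserving S P (serviceLaw μ)) {f : Ω → ℝ}
    (hf : f =ᵐ[P] fun ω =>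
      g (window T ((cutSeq T)^[i] (S ω)), window T ((cutSeq T)^[i + 1] (S ω)))) :
    HasMean P f m := by
  have := isProbabilityMeasure_serviceLaw hμ
  have hid := (identDistrib_iterate_pair (measurable_cutSeq T) (measurable_window T)
    (measure_window_inter_cutSeq hμ hT) i).comp hg
  have hm : Measurable fun s =>
      g (window T ((cutSeq T)^[i] s), window T ((cutSeq T)^[i + 1] s)) := by
    have h1 := (measurable_window T).comp ((measurable_cutSeq T).iterate i)
    have h2 := (measurable_window T).comp ((measurable_cutSeq T).iterate (i + 1))
    exact hg.comp (h1.prodMk h2)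
  have hint : Integrable (fun s =>
      g (window T ((cutSeq T)^[i] s), window T ((cutSeq T)^[i + 1] s))) (serviceLaw μ) :=
    hid.integrable_iff.2 h.1
  refine ⟨(hS.integrable_comp_of_integrable hint).congr hf.symm, ?_⟩
  rw [integral_congr_ae hf, ← h.2]
  refine Eq.trans ?_ hid.integral_eq
  rw [← hS.map_eq]
  exact (integral_map hS.measurable.aemeasurable hm.aestronglyMeasurable).symm

theorem meanSum_div_meanCount {μ T : ℝ} (hμ : 0 < μ) (hT : 0 < T) :
    (2 * (μ * T) + (μ * T) ^ 2 * Real.exp (-(μ * T)) - 2 * Real.exp (-(μ * T))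
        + 2 * Real.exp (-(μ * T)) ^ 2 + 2 * (μ * T) * Real.exp (-(μ * T)) ^ 2) / μ
      / (μ * T + μ * T * Real.exp (-(μ * T)) + Real.exp (-(μ * T)) ^ 2)
    = (2 + 2 * μ * T + Real.exp (μ * T) * (-2 + μ * T * (2 * Real.exp (μ * T) + μ * T))) /
        (μ * (1 + Real.exp (μ * T) * (1 + Real.exp (μ * T)) * μ * T)) := by
  -- The two forms differ by the factor `exp (μT) ^ 2` in numerator and denominator.
  rw [Real.exp_neg]
  have hE := Real.exp_pos (μ * T)
  generalize Real.exp (μ * T) = E at *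
  rw [div_div, div_eq_div_iff (by positivity) (by positivity)]
  field_simp
  ring

end

theorem proposition3 {Ω : Type*} [MeasurableSpace Ω] (P : Measure Ω) [IsProbabilityMeasure P]
    (μ T Δ₀ : ℝ) (hμ : 0 < μ) (hT : 0 < T) (hΔ₀ : 0 ≤ Δ₀)
    (S : ℕ → Ω → ℝ) (hSmeas : ∀ i, Measurable (S i))
    (hSindep : iIndepFun S P) (hSlaw : ∀ i, P.map (S i) = expMeasure μ) :
    let U : Ω → Set (ℝ × ℝ) := fun ω => updatesMD (fun i => S i ω) T
    let period : ℕ → Set ℝ := fun j => Set.Ioc (j * T) ((j + 1) * T)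
    let peakAoI : ℝ :=
      (2 + 2 * μ * T + Real.exp (μ * T) * (-2 + μ * T * (2 * Real.exp (μ * T) + μ * T))) /
        (μ * (1 + Real.exp (μ * T) * (1 + Real.exp (μ * T)) * μ * T))
    -- almost surely, the long-run average of the peaks exists and has the stated value
    (∀ᵐ ω ∂P,
      (∀ τ : ℝ, (peakTimes Δ₀ (U ω) ∩ Set.Ioc 0 τ).Finite) ∧
      Tendsto (fun τ : ℝ =>
        peakSum Δ₀ (U ω) (Set.Ioc 0 τ) / peakCount Δ₀ (U ω) (Set.Ioc 0 τ)) atTop (𝓝 peakAoI)) ∧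
    -- in every service period that has a predecessor: mean sum of peaks over mean number of peaks
    (∀ j : ℕ, 1 ≤ j →
      Integrable (fun ω => peakSum Δ₀ (U ω) (period j)) P ∧
      Integrable (fun ω => peakCount Δ₀ (U ω) (period j)) P ∧
      (∫ ω, peakSum Δ₀ (U ω) (period j) ∂P) / (∫ ω, peakCount Δ₀ (U ω) (period j) ∂P)
        = peakAoI) := by
  intro U period peakAoI
  have hρ := isProbabilityMeasure_serviceLaw hμ
  have hS : MeasurePreserving (fun ω i => S i ω) P (serviceLaw μ) := by
    refine ⟨measurable_pi_iff.2 hSmeas, ?_⟩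
    rw [hSindep.map_fun_eq_infinitePi_map hSmeas, serviceLaw]
    simp_rw [hSlaw]
  have hreg : ∀ᵐ ω ∂P, IsRegularService T (fun i => S i ω) :=
    hS.quasiMeasurePreserving.ae (ae_forall_iterate_cutSeq hμ hT)
  have hmS := hasMean_periodSum hμ hT
  have hmC := hasMean_periodCount hμ hT
  have hval := meanSum_div_meanCount hμ hT
  refine ⟨?_, fun j hj => ?_⟩
  · have lS := hS.quasiMeasurePreserving.ae (ae_tendsto_average_pair (measurable_cutSeq T)
      (measurable_window T) (measure_window_inter_cutSeq hμ hT) (measurable_periodSum T) hmS.1)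
    have lC := hS.quasiMeasurePreserving.ae (ae_tendsto_average_pair (measurable_cutSeq T)
      (measurable_window T) (measure_window_inter_cutSeq hμ hT) measurable_periodCount hmC.1)
    filter_upwards [hreg, lS, lC] with ω h1 h2 h3
    refine ⟨h1.finite_peakTimes hT 0, ?_⟩
    rw [hmS.2] at h2
    rw [hmC.2] at h3
    have := h1.tendsto_average_peak hT hΔ₀ h2 h3 (by positivity)
    rw [hval] at this
    exact this
  · obtain ⟨i, rfl⟩ : ∃ i, j = i + 1 := ⟨j - 1, by omega⟩
    have hper : period (i + 1) = Set.Ioc ((i + 1) * T) ((i + 2) * T) := by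
      simp only [period]
      push_cast
      rw [add_assoc, one_add_one_eq_two]
    rw [hper]
    have kS : HasMean P (fun ω => peakSum Δ₀ (U ω) (Set.Ioc ((i + 1) * T) ((i + 2) * T))) _ :=
      hmS.comp_iterate_pair hμ hT (measurable_periodSum T) i hS (by
        filter_upwards [hreg] with ω h1
        exact h1.peakSum_eq hT hΔ₀ i)
    have kC : HasMean P (fun ω => peakCount Δ₀ (U ω) (Set.Ioc ((i + 1) * T) ((i + 2) * T))) _ :=
      hmC.comp_iterate_pair hμ hT measurable_periodCount i hS (by
        filter_upwards [hreg] with ω h1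
        exact h1.peakCount_eq hT hΔ₀ i)
    refine ⟨kS.1, kC.1, ?_⟩
    rw [kS.2, kC.2, hval]
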